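/- Let $C$ be a finite set of candidates. A vote is a subset of $C$ (the approved candidates), and an election is a pair $(C,V)$ with $V$ a multiset of votes. For an integer $k$, a $k$-committee is a $k$-element subset of $C$, and a winning $k$-committee of approval voting (AV) at $(C,V)$ is a $k$-committee $w$ with $\sum_{v\in V}|v\cap w|\ge\sum_{v\in V}|v\cap w'|$ for all $k$-committees $w'\subseteq C$; let $\mathrm{AV}(C,V,k)$ be the collection of all of them. An instance of Cardinality-Based Coalition Manipulation for AV (CBCM-AV) consists of a finite candidate set $C$, two multisets $V$ and $V_{\mathrm M}$ of votes over $C$ (nonmanipulative and manipulative votes), and a winning committee $w\in\mathrm{AV}(C,V\cup V_{\mathrm M},k)$, where $k=|w|$. The question is whether there is a multiset $U$ of $|V_{\mathrm M}|$ votes over $C$ such that for all $w'\in\mathrm{AV}(C,V\cup U,k)$ and all $v\in V_{\mathrm M}$ it holds that $|v\cap w'|>|v\cap w|$. Subset-Based Coalition Manipulation for AV (SBCM-AV) has the same instances, and its question is obtained by replacing $|v\cap w'|>|v\cap w|$ with $(v\cap w)\subsetneq(v\cap w')$. (Here $\cup$ is the union of multisets that adds multiplicities.) **Theorem.** CBCM-AV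 and SBCM-AV are polynomial-time solvable if there are a constant number of manipulators. That is, for every fixed $t\in\mathbb N$, each of the two problems, restricted to instances with $|V_{\mathrm M}|\le t$, is decided by a (multi-stack) Turing machine in time polynomial in the length of the input. Here an instance is encoded over a finite alphabet by one symbol for each manipulative and each nonmanipulative vote, followed by one line for each candidate with one bit for membership in $w$ and one bit for each vote telling whether the vote approves the candidate. -/

import Mathlib

/-! ### Approval-based multiwinner voting

A vote over the candidate set `C` is the finite set of approved candidates, an election is a
multiset of votes, and a multiwinner rule (on a fixed candidate set) maps an election and a
committee size to the collection of winning committees. -/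

/-- The AV score of a committee: the total number of approvals received by its members. -/
def avScore {C : Type} [DecidableEq C] (V : Multiset (Finset C)) (w : Finset C) : ℕ :=
  (V.map fun v => (v ∩ w).card).sum

/-- Approval voting: the collection of winning `k`-committees, i.e. of the `k`-committees with the
maximum AV score among all `k`-committees. -/
def AV {C : Type} [DecidableEq C] (V : Multiset (Finset C)) (k : ℕ) : Set (Finset C) :=
  {w | w.card = k ∧ ∀ w' : Finset C, w'.card = k → avScore V w' ≤ avScore V w}

/-- The question of Cardinality-Based Coalition Manipulation for the rule `φ`: can the manipulators
replace their votes `VM` by equally many votes `U` so that every manipulator has strictly more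
truthfully approved candidates in every new winning committee than in `w`? -/
def CBCM {C : Type} [DecidableEq C] (φ : Multiset (Finset C) → ℕ → Set (Finset C))
    (V VM : Multiset (Finset C)) (w : Finset C) : Prop :=
  ∃ U : Multiset (Finset C), U.card = VM.card ∧
    ∀ w' ∈ φ (V + U) w.card, ∀ v ∈ VM, (v ∩ w).card < (v ∩ w').card

/-- The question of Subset-Based Coalition Manipulation for the rule `φ`: as `CBCM`, but every
manipulator compares committees by strict inclusion of their truthfully approved parts. -/
def SBCM {C : Type} [DecidableEq C] (φ : Multiset (Finset C) → ℕ → Set (Finset C))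
    (V VM : Multiset (Finset C)) (w : Finset C) : Prop :=
  ∃ U : Multiset (Finset C), U.card = VM.card ∧
    ∀ w' ∈ φ (V + U) w.card, ∀ v ∈ VM, v ∩ w ⊂ v ∩ w'

/-! ### Instances and their encoding -/

/-- An instance of CBCM and SBCM for AV. The candidates are numbered `0, …, m - 1`, and the
multisets of nonmanipulative votes `V` and of manipulative votes `VM` are given as lists. -/
structure ManipulationInstance where
  /-- the number of candidates -/
  m : ℕ
  /-- the nonmanipulative votes -/
  V : List (Finset (Fin m))
  /-- the manipulative votes -/
  VM : List (Finset (Fin m))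
  /-- the current winning committee -/
  w : Finset (Fin m)
  /-- the committee `w` is indeed winning in the current election -/
  winning : w ∈ AV ((V : Multiset (Finset (Fin m))) + (VM : Multiset (Finset (Fin m)))) w.card

/-- The finite input alphabet. -/
inductive InputSymbol : Type
  | manipulator
  | voter
  | candidate
  | bit (b : Bool)

namespace ManipulationInstance

/-- The line of candidate `c` in the input: a marker, one bit telling whether `c` belongs to the
committee, and one bit for each vote (manipulative votes first) telling whether it approves `c`. -/
def line (I : ManipulationInstance) (c : Fin I.m) : List InputSymbol :=
  InputSymbol.candidate :: InputSymbol.bit (decide (c ∈ I.w)) ::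
    (I.VM ++ I.V).map fun v => InputSymbol.bit (decide (c ∈ v))

/-- The encoding of an instance: a header with one symbol for each manipulator and one symbol for
each other voter, followed by the approval matrix, one line for each candidate. Its length is
`|VM| + |V| + m * (2 + |VM| + |V|)`. -/
def encode (I : ManipulationInstance) : List InputSymbol :=
  I.VM.map (fun _ => InputSymbol.manipulator) ++ I.V.map (fun _ => InputSymbol.voter) ++
    (List.finRange I.m).flatMap I.line

end ManipulationInstance

namespace ManipulationInstance

theorem length_line (I : ManipulationInstance) (c : Fin I.m) :
    (I.line c).length = 2 + (I.VM.length + I.V.length) := by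
  simp [line]; omega

/-- The length of the encoding. -/
theorem length_encode (I : ManipulationInstance) :
    I.encode.length =
      I.VM.length + I.V.length + I.m * (2 + (I.VM.length + I.V.length)) := by
  simp [encode, List.length_flatMap, length_line, Nat.add_assoc]

theorem flatMap_inj_of_length {α β : Type} (n : ℕ) (l : List α) (f g : α → List β)
    (hf : ∀ a, (f a).length = n) (hg : ∀ a, (g a).length = n)
    (h : l.flatMap f = l.flatMap g) : ∀ a ∈ l, f a = g a := by
  induction l with
  | nil => simp
  | cons a l ih =>
    rw [List.flatMap_cons, List.flatMap_cons] at h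
    obtain ⟨h1, h2⟩ := List.append_inj h ((hf a).trans (hg a).symm)
    simpa [h1] using ih h2

theorem votes_inj {m : ℕ} (l l' : List (Finset (Fin m))) (hl : l.length = l'.length)
    (h : ∀ c : Fin m, l.map (fun v => InputSymbol.bit (decide (c ∈ v))) =
      l'.map (fun v => InputSymbol.bit (decide (c ∈ v)))) : l = l' := by
  refine List.ext_getElem hl fun i h1 h2 => ?_
  ext c
  have := congrArg (fun s => s[i]?) (h c)
  simpa [h1, h2] using this

/-- The encoding is faithful: different instances are encoded by different strings. -/
theorem encode_injective : Function.Injective encode := by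
  intro I J h
  have key : ∀ p : InputSymbol → Bool, I.encode.countP p = J.encode.countP p := fun p => by rw [h]
  have hM := key (fun s => match s with | .manipulator => true | _ => false)
  have hV := key (fun s => match s with | .voter => true | _ => false)
  have hC := key (fun s => match s with | .candidate => true | _ => false)
  simp [encode, line, List.countP_append, List.countP_map, List.countP_flatMap,
    List.countP_replicate, Function.comp_def] at hM hV hC
  obtain ⟨m, V, VM, w, hw⟩ := I
  obtain ⟨m', V', VM', w', hw'⟩ := J
  dsimp only at hM hV hC
  subst hC
  unfold encode at h
  have h2 := (List.append_inj h (by simp [hM, hV])).2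
  have h3 := flatMap_inj_of_length (2 + (VM.length + V.length)) _ _ _
    (fun c => length_line _ c) (fun c => by rw [length_line]; simp [hM, hV]) h2
  have hw : w = w' := by
    ext c
    have := h3 c (List.mem_finRange c)
    simp only [line, List.cons.injEq, InputSymbol.bit.injEq, decide_eq_decide] at this
    exact this.2.1
  have hL : VM ++ V = VM' ++ V' := by
    refine votes_inj _ _ (by simp [hM, hV]) fun c => ?_
    have := h3 c (List.mem_finRange c)
    simp only [line, List.cons.injEq] at this
    exact this.2.2
  obtain ⟨rfl, rfl⟩ := List.append_inj hL hM
  subst hw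
  rfl

end ManipulationInstance

/-! ### Polynomial-time solvability -/

/-- The decision problem `P`, whose instances `a : α` are given to the machine as the strings
`enc a`, is polynomial-time solvable: some Turing machine outputs on every instance the correct
answer, within a number of steps bounded by a polynomial in the length of the input. -/
def PolyTimeSolvable {α Γ : Type} (enc : α → List Γ) (P : α → Prop) : Prop :=
  ∃ f : α → Bool, (∀ a, f a = true ↔ P a) ∧
    Nonempty (Turing.TM2ComputableInPolyTime enc Computability.encodeBool f)

/-! Why a constant number of manipulators helps. AV sees the votes only through the scores of the
candidates. Suppose that some `U` is a successful manipulation, and let `x` be a winning committee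
under `V + U`. If all manipulators approve exactly `x` instead, then members of `x` gain and all
others lose compared with `U`; so no new winning committee arises and the manipulation still
succeeds (`exists_votes_iff`). It remains to search for `x`. Candidates that agree on `w` and on all
manipulative votes are interchangeable for the goal, so a member of `x` may be traded for a higher
ranked candidate of the same type. Hence `x` may be taken upward closed within each type
(`exists_isTopCommittee_upward_closed`). With `t` manipulators there are at most `2 ^ (t + 1)`
types, and one lowest member for each of them describes `x`.

Testing a given `x`. For a suitable threshold, the new winning committees are the `k`-sets between
the set `F` of candidates above the threshold and the set `G` of candidates that reach it
(`isTopCommittee_iff_of_threshold`). The fewest elements of a set `A` in such a committee number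
`max |F ∩ A| (k - |G \ A|)` (`forall_le_card_inter_iff`), so both goals become comparisons of
cardinalities.

Why this runs in polynomial time. Guessing the cuts and the threshold and testing them is expressed
by one formula over the input string, depending only on `t`, whose only quantifier compares numbers
of positions (`holds_manipulationF`). Such a formula is evaluated by a fixed number of heads, where
each quantifier costs two sweeps over the string (`execIn_program`). A program for heads is a stack
machine with two stacks per head, step for step (`reachesIn_code`). -/

/-! ### Counting formulas over a string -/

/-- Formulas over the positions of a string, with variables named by natural numbers. The only
quantifier compares the numbers of positions that satisfy two formulas. -/
inductive CountingFormula (A : Type) : Type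
  | sym (x : ℕ) (a : A)
  | le (x y : ℕ)
  | not (φ : CountingFormula A)
  | and (φ ψ : CountingFormula A)
  | cmp (x : ℕ) (φ ψ : CountingFormula A)

namespace CountingFormula

variable {A : Type}

/-- The truth value of a formula over the string `T`: `sym x a` says that `a` stands at position
`x`, and `cmp x φ ψ` that at most as many positions `x` satisfy `φ` as satisfy `ψ`. -/
def eval [DecidableEq A] (T : List A) : CountingFormula A → (ℕ → ℕ) → Bool
  | sym x a, e => decide (T[e x]? = some a)
  | le x y, e => decide (e x ≤ e y)
  | not φ, e => !eval T φ e
  | and φ ψ, e => eval T φ e && eval T ψ e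
  | cmp x φ ψ, e =>
    decide (Nat.count (fun p => eval T φ (Function.update e x p)) T.length ≤
      Nat.count (fun p => eval T ψ (Function.update e x p)) T.length)

end CountingFormula

/-! ### Structured programs moving heads over a string -/

/-- Structured programs with a Boolean flag and heads `x : V` on the input string. The flag is set
by looking at the symbol to the right (`look`) or to the left (`back`) of a head. -/
inductive HeadProgram (A V : Type) : Type
  | inc (x : V)
  | dec (x : V)
  | look (x : V) (f : Option A → Bool → Bool)
  | back (x : V) (f : Option A → Bool → Bool)
  | seq (c d : HeadProgram A V)
  | ite (c d : HeadProgram A V)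
  | loop (c d : HeadProgram A V)

namespace HeadProgram

variable {A V : Type} [DecidableEq V]

/-- `Exec T c b q b' q' n`: over the string `T`, the program `c` started with flag `b` and head
positions `q` stops after `n` steps with flag `b'` and head positions `q'`. -/
inductive Exec (T : List A) :
    HeadProgram A V → Bool → (V → ℕ) → Bool → (V → ℕ) → ℕ → Prop
  | inc {x b q} : Exec T (inc x) b q b (Function.update q x (min (q x + 1) T.length)) 1
  | dec {x b q} : Exec T (dec x) b q b (Function.update q x (q x - 1)) 1
  | look {x f b q} : Exec T (look x f) b q (f T[q x]? b) q 1
  | back {x f b q} : Exec T (back x f) b q (f (T.take (q x)).getLast? b) q 1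
  | seq {c d b₁ q₁ b₂ q₂ b₃ q₃ n₁ n₂} : Exec T c b₁ q₁ b₂ q₂ n₁ → Exec T d b₂ q₂ b₃ q₃ n₂ →
      Exec T (seq c d) b₁ q₁ b₃ q₃ (n₁ + n₂)
  | ite_true {c d q₁ b₂ q₂ n} : Exec T c true q₁ b₂ q₂ n → Exec T (ite c d) true q₁ b₂ q₂ (1 + n)
  | ite_false {c d q₁ b₂ q₂ n} :
      Exec T d false q₁ b₂ q₂ n → Exec T (ite c d) false q₁ b₂ q₂ (1 + n)
  | loop_exit {c d b₁ q₁ q₂ n} : Exec T c b₁ q₁ false q₂ n →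
      Exec T (loop c d) b₁ q₁ false q₂ (n + 1)
  | loop_step {c d b₁ q₁ q₂ b₃ q₃ b₄ q₄ n₁ n₂ n₃} : Exec T c b₁ q₁ true q₂ n₁ →
      Exec T d true q₂ b₃ q₃ n₂ → Exec T (loop c d) b₃ q₃ b₄ q₄ n₃ →
      Exec T (loop c d) b₁ q₁ b₄ q₄ (n₁ + 1 + n₂ + n₃)

/-- Execution within a number of steps. -/
def ExecIn (T : List A) (c : HeadProgram A V) (b : Bool) (q : V → ℕ) (b' : Bool) (q' : V → ℕ)
    (B : ℕ) : Prop :=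
  ∃ n ≤ B, Exec T c b q b' q' n

variable {T : List A} {c d : HeadProgram A V} {b b₁ b₂ b₃ : Bool} {q q₁ q₂ q₃ : V → ℕ}
  {x : V} {B B₁ B₂ : ℕ}

theorem Exec.pos_le {n : ℕ} (h : Exec T c b₁ q₁ b₂ q₂ n) (hq : ∀ x, q₁ x ≤ T.length) :
    ∀ x, q₂ x ≤ T.length := by
  induction h with
  | @inc x b q =>
    intro y
    rcases eq_or_ne y x with rfl | h
    · simp
    · simp [h, hq]
  | @dec x b q =>
    intro y
    rcases eq_or_ne y x with rfl | h
    · have := hq y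
      simp only [Function.update_self]
      omega
    · simp [h, hq]
  | look => exact hq
  | back => exact hq
  | seq _ _ ih₁ ih₂ => exact ih₂ (ih₁ hq)
  | ite_true _ ih => exact ih hq
  | ite_false _ ih => exact ih hq
  | loop_exit _ ih => exact ih hq
  | loop_step _ _ _ ih₁ ih₂ ih₃ => exact ih₃ (ih₂ (ih₁ hq))

theorem Exec.inc_of_eq (h : q₂ = Function.update q x (min (q x + 1) T.length)) :
    Exec T (HeadProgram.inc x) b q b q₂ 1 :=
  h ▸ .inc

theorem Exec.dec_of_eq (h : q₂ = Function.update q x (q x - 1)) :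
    Exec T (HeadProgram.dec x) b q b q₂ 1 :=
  h ▸ .dec

theorem ExecIn.mono (h : ExecIn T c b₁ q₁ b₂ q₂ B) (hB : B ≤ B₁) : ExecIn T c b₁ q₁ b₂ q₂ B₁ := by
  obtain ⟨n, hn, h⟩ := h
  exact ⟨n, hn.trans hB, h⟩

theorem ExecIn.seq (h₁ : ExecIn T c b₁ q₁ b₂ q₂ B₁) (h₂ : ExecIn T d b₂ q₂ b₃ q₃ B₂) :
    ExecIn T (seq c d) b₁ q₁ b₃ q₃ (B₁ + B₂) := by
  obtain ⟨n₁, hn₁, h₁⟩ := h₁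
  obtain ⟨n₂, hn₂, h₂⟩ := h₂
  exact ⟨n₁ + n₂, by omega, h₁.seq h₂⟩

theorem ExecIn.ite (h₁ : b₁ = true → ExecIn T c true q₁ b₂ q₂ B)
    (h₂ : b₁ = false → ExecIn T d false q₁ b₂ q₂ B) :
    ExecIn T (HeadProgram.ite c d) b₁ q₁ b₂ q₂ (1 + B) := by
  cases b₁
  · obtain ⟨n, hn, h⟩ := h₂ rfl
    exact ⟨1 + n, by omega, h.ite_false⟩
  · obtain ⟨n, hn, h⟩ := h₁ rfl
    exact ⟨1 + n, by omega, h.ite_true⟩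

theorem ExecIn.look {f : Option A → Bool → Bool} : ExecIn T (look x f) b q (f T[q x]? b) q 1 :=
  ⟨1, le_rfl, .look⟩

theorem ExecIn.back {f : Option A → Bool → Bool} :
    ExecIn T (back x f) b q (f (T.take (q x)).getLast? b) q 1 :=
  ⟨1, le_rfl, .back⟩

/-- There is a symbol to the left of a head exactly when the head is not at 0, so `back` serves as a
zero test for heads used as counters. -/
theorem isSome_getLast?_take {n : ℕ} (hn : n ≤ T.length) :
    (T.take n).getLast?.isSome = decide (0 < n) := by
  rcases Nat.eq_zero_or_pos n with rfl | h
  · simp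
  · have : T.take n ≠ [] := by
      rw [← List.length_pos_iff, List.length_take]
      omega
    rw [List.getLast?_eq_some_getLast this, decide_eq_true h, Option.isSome_some]

/-- A loop whose state before the `p`-th round is `q p` and which makes `N` rounds. -/
theorem ExecIn.loop (q : ℕ → V → ℕ) (N : ℕ)
    (h₁ : ∀ p < N, ∀ b, ExecIn T c b (q p) true (q p) B)
    (h₂ : ∀ b, ExecIn T c b (q N) false (q N) B)
    (h₃ : ∀ p < N, ∃ b, ExecIn T d true (q p) b (q (p + 1)) B) (b : Bool) :
    ExecIn T (loop c d) b (q 0) false (q N) ((N + 1) * (2 * B + 1)) := by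
  induction N generalizing q b with
  | zero =>
    obtain ⟨n, hn, h⟩ := h₂ b
    exact ⟨n + 1, by omega, h.loop_exit⟩
  | succ N ih =>
    obtain ⟨n₁, hn₁, h₁'⟩ := h₁ 0 (by omega) b
    obtain ⟨b', n₂, hn₂, h₃'⟩ := h₃ 0 (by omega)
    obtain ⟨n₃, hn₃, h⟩ := ih (fun p => q (p + 1)) (fun p hp => h₁ _ (by omega)) h₂
      (fun p hp => h₃ _ (by omega)) b'
    refine ⟨n₁ + 1 + n₂ + n₃, ?_, h₁'.loop_step h₃' h⟩
    have : (N + 1 + 1) * (2 * B + 1) = (N + 1) * (2 * B + 1) + (2 * B + 1) := by ring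
    omega

/-- Do nothing. -/
def skip (x : V) : HeadProgram A V := look x fun _ b => b

/-- Set the flag. -/
def setFlag (x : V) (b : Bool) : HeadProgram A V := look x fun _ _ => b

/-- Move a head to the left end. -/
def rewind (x : V) : HeadProgram A V := loop (back x fun o _ => o.isSome) (dec x)

theorem execIn_skip : ExecIn T (skip x) b q b q 1 := ⟨1, le_rfl, .look⟩

theorem execIn_setFlag : ExecIn T (setFlag x b₁) b q b₁ q 1 := ⟨1, le_rfl, .look⟩

theorem execIn_rewind (hq : q x ≤ T.length) :
    ExecIn T (rewind x) b q false (Function.update q x 0) ((T.length + 1) * 3) := by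
  have h := ExecIn.loop (T := T) (c := back x fun o _ => o.isSome) (d := dec x) (B := 1)
    (fun p => Function.update q x (q x - p)) (q x) (fun p hp b => ?_) (fun b => ?_)
    (fun p hp => ⟨true, ?_⟩) b
  · simp only [Nat.sub_zero, Function.update_eq_self, Nat.sub_self] at h
    exact h.mono (by gcongr)
  · have h := ExecIn.back (T := T) (x := x) (b := b) (q := Function.update q x (q x - p))
      (f := fun o _ => o.isSome)
    rw [isSome_getLast?_take (by simp; omega)] at h
    simpa [hp] using h
  · have h := ExecIn.back (T := T) (x := x) (b := b) (q := Function.update q x (q x - q x))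
      (f := fun o _ => o.isSome)
    rw [isSome_getLast?_take (by simp)] at h
    simpa using h
  · refine ⟨1, le_rfl, .dec_of_eq ?_⟩
    simp [Nat.sub_sub]

/-- Sweep the head `x` over the string and run `c` at each position. -/
def sweep (x : V) (c : HeadProgram A V) : HeadProgram A V :=
  seq (loop (look x fun o _ => o.isSome) (seq c (inc x))) (rewind x)

/-- Here `q p` is the state when `x` arrives at position `p`. The body has to bring the other heads
to their places in `q (p + 1)` while `x` is still at `p`, because the sweep itself advances `x`. -/
theorem execIn_sweep (q : ℕ → V → ℕ) (hx : ∀ p ≤ T.length, q p x = p)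
    (h : ∀ p < T.length, ∃ b, ExecIn T c true (q p) b (Function.update (q (p + 1)) x p) B) :
    ExecIn T (sweep x c) b (q 0) false (Function.update (q T.length) x 0)
      ((T.length + 1) * (2 * (B + 1) + 1) + (T.length + 1) * 3) := by
  refine ExecIn.seq (b₂ := false) (q₂ := q T.length)
    (ExecIn.loop q T.length (fun p hp b => ?_) (fun b => ?_) (fun p hp => ?_) b)
    (execIn_rewind (hx _ le_rfl).le)
  · have h := ExecIn.look (T := T) (x := x) (b := b) (q := q p) (f := fun o _ => o.isSome)
    rw [hx p hp.le] at h
    simp only [List.getElem?_eq_getElem hp, Option.isSome_some] at h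
    exact h.mono (by omega)
  · have h := ExecIn.look (T := T) (x := x) (b := b) (q := q T.length) (f := fun o _ => o.isSome)
    rw [hx _ le_rfl] at h
    simp only [List.getElem?_length, Option.isSome_none] at h
    exact h.mono (by omega)
  · obtain ⟨b, hb⟩ := h p hp
    refine ⟨b, hb.seq ⟨1, le_rfl, .inc_of_eq ?_⟩⟩
    have := hx (p + 1) hp
    simp only [Function.update_self, Function.update_idem]
    rw [min_eq_left (by omega)]
    nth_rw 1 [← Function.update_eq_self x (q (p + 1)), this]

/-- Compare the heads `x` and `y`, using the auxiliary head `z`. -/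
def compare (x y z : V) : HeadProgram A V :=
  let restore : HeadProgram A V :=
    loop (back z fun o _ => o.isSome) (seq (dec z) (seq (inc x) (inc y)))
  seq (loop (seq (back x fun o _ => o.isSome) (back y fun o b => b && o.isSome))
      (seq (dec x) (seq (dec y) (inc z))))
    (seq (back x fun o _ => o.isNone)
      (ite (seq restore (setFlag x true)) (seq restore (setFlag x false))))

/-- The heads `x` and `y` move left together until one of them is at 0, while `z` counts the rounds.
Then `x` is at 0 exactly if `q x ≤ q y`, and `z` tells how far both have to move back. -/
theorem execIn_compare {y z : V} (hxy : x ≠ y) (hxz : x ≠ z) (hyz : y ≠ z)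
    (hq : ∀ v, q v ≤ T.length) (hz : q z = 0) :
    ExecIn T (compare x y z) b q (decide (q x ≤ q y)) q (20 * (T.length + 1)) := by
  have hX := hq x
  have hY := hq y
  -- The state after `p` joint moves to the left.
  let r : ℕ → V → ℕ := fun p =>
    Function.update (Function.update (Function.update q x (q x - p)) y (q y - p)) z p
  have rx : ∀ p, r p x = q x - p := fun p => by simp [r, hxy, hxz]
  have ry : ∀ p, r p y = q y - p := fun p => by simp [r, hyz]
  have rz : ∀ p, r p z = p := fun p => by simp [r]
  have rv : ∀ p v, v ≠ x → v ≠ y → v ≠ z → r p v = q v := fun p v h₁ h₂ h₃ => by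
    simp [r, h₁, h₂, h₃]
  have r0 : r 0 = q := by
    funext v
    rcases eq_or_ne v x with rfl | h₁
    · simp [rx]
    rcases eq_or_ne v y with rfl | h₂
    · simp [ry]
    rcases eq_or_ne v z with rfl | h₃
    · simp [rz, hz]
    exact rv _ _ h₁ h₂ h₃
  have hback : ∀ (v : V) (p : ℕ) (b : Bool), r p v ≤ T.length →
      ExecIn T (back v fun o _ => o.isSome) b (r p) (decide (0 < r p v)) (r p) 1 :=
    fun v p b h => by
      rw [← isSome_getLast?_take h]
      exact ExecIn.back
  have hback' : ∀ (v : V) (p : ℕ) (b : Bool), r p v ≤ T.length →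
      ExecIn T (back v fun o b => b && o.isSome) b (r p) (b && decide (0 < r p v)) (r p) 1 :=
    fun v p b h => by
      rw [← isSome_getLast?_take h]
      exact ExecIn.back
  have hrestore : ∀ b,
      ExecIn T (loop (back z fun o _ => o.isSome) (seq (dec z) (seq (inc x) (inc y))))
      b (r (min (q x) (q y))) false q ((T.length + 1) * 7) := by
    intro b
    have h := ExecIn.loop (T := T) (c := back z fun o _ => o.isSome)
      (d := seq (dec z) (seq (inc x) (inc y))) (B := 3)
      (fun p => r (min (q x) (q y) - p)) (min (q x) (q y)) (fun p hp b => ?_) (fun b => ?_)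
      (fun p hp => ⟨true, ?_⟩) b
    · simp only [Nat.sub_zero, Nat.sub_self, r0] at h
      exact h.mono (by gcongr; omega)
    · have := hback z (min (q x) (q y) - p) b (by rw [rz]; omega)
      rw [rz, decide_eq_true (by omega)] at this
      exact this.mono (by omega)
    · have := hback z (min (q x) (q y) - min (q x) (q y)) b (by rw [rz]; omega)
      rw [rz, decide_eq_false (by omega)] at this
      exact this.mono (by omega)
    · refine ⟨3, le_rfl, Exec.dec.seq (Exec.inc.seq (.inc_of_eq ?_))⟩
      funext v
      rcases eq_or_ne v y with rfl | h₂
      · simp [ry, hxy.symm, hyz]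
        omega
      rcases eq_or_ne v x with h₁ | h₁
      · simp [h₁, rx, hxy, hxz]
        omega
      rcases eq_or_ne v z with rfl | h₃
      · simp [rz, h₁, h₂]
        omega
      simp [rv, h₁, h₂, h₃]
  have h₁ : ExecIn T (loop (seq (back x fun o _ => o.isSome) (back y fun o b => b && o.isSome))
      (seq (dec x) (seq (dec y) (inc z)))) b q false (r (min (q x) (q y)))
      ((T.length + 1) * 7) := by
    have h := ExecIn.loop (T := T)
      (c := seq (back x fun o _ => o.isSome) (back y fun o b => b && o.isSome))
      (d := seq (dec x) (seq (dec y) (inc z))) (B := 3) r (min (q x) (q y))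
      (fun p hp b => ?_) (fun b => ?_) (fun p hp => ⟨true, ?_⟩) b
    · rw [r0] at h
      exact h.mono (by gcongr; omega)
    · have := (hback x p b (by rw [rx]; omega)).seq (hback' y p _ (by rw [ry]; omega))
      rw [rx, ry, decide_eq_true (by omega), decide_eq_true (by omega)] at this
      exact this.mono (by omega)
    · have := (hback x (min (q x) (q y)) b (by rw [rx]; omega)).seq
        (hback' y (min (q x) (q y)) _ (by rw [ry]; omega))
      rw [rx, ry, ← Bool.decide_and, decide_eq_false (by omega)] at this
      exact this.mono (by omega)
    · refine ⟨3, le_rfl, Exec.dec.seq (Exec.dec.seq (.inc_of_eq ?_))⟩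
      funext v
      rcases eq_or_ne v z with rfl | h₃
      · simp [rz, hxz.symm, hyz.symm]
        omega
      rcases eq_or_ne v y with rfl | h₂
      · simp [ry, hxy.symm, hyz]
        omega
      rcases eq_or_ne v x with h₁ | h₁
      · simp [h₁, rx, hxy, hxz]
        omega
      simp [rv, h₁, h₂, h₃]
  have h₂ : ExecIn T (back x fun o _ => o.isNone) false (r (min (q x) (q y)))
      (decide (q x ≤ q y)) (r (min (q x) (q y))) 1 := by
    have h := ExecIn.back (T := T) (x := x) (b := false) (q := r (min (q x) (q y)))
      (f := fun o _ => o.isNone)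
    rw [← Option.not_isSome, isSome_getLast?_take (by rw [rx]; omega), rx] at h
    convert h using 1
    rw [← decide_not]
    congr 1
    rw [eq_iff_iff]
    omega
  refine (h₁.seq (h₂.seq (ExecIn.ite (fun h => ?_) fun h => ?_))).mono
    (?_ : _ + (1 + (1 + ((T.length + 1) * 7 + 1))) ≤ _)
  · exact h ▸ (hrestore _).seq execIn_setFlag
  · exact h ▸ (hrestore _).seq execIn_setFlag
  · omega

end HeadProgram

/-! ### Evaluating counting formulas with heads -/

namespace CountingFormula

open HeadProgram

variable {A V : Type}

/-- The number of heads needed to evaluate a formula if `d` heads are in use already. -/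
def heads : CountingFormula A → ℕ → ℕ
  | sym _ _, d => d + 1
  | le _ _, d => d + 1
  | not φ, d => heads φ d
  | and φ ψ, d => max (heads φ d) (heads ψ d)
  | cmp _ φ ψ, d => max (heads φ (d + 2)) (heads ψ (d + 2))

theorem lt_heads (φ : CountingFormula A) (d : ℕ) : d < φ.heads d := by
  induction φ generalizing d with
  | sym => simp [heads]
  | le => simp [heads]
  | not φ ih => exact ih d
  | and φ ψ ih₁ ih₂ => exact lt_max_of_lt_left (ih₁ d)
  | cmp x φ ψ ih₁ ih₂ => exact lt_max_of_lt_left (by have := ih₁ (d + 2); omega)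

variable [DecidableEq A] [DecidableEq V]

/-- The program that evaluates a formula. The variable `x` is held by the head `ρ x`, and the heads
`h i` with `d ≤ i` are free. -/
def program (h : ℕ → V) : CountingFormula A → (ℕ → V) → ℕ → HeadProgram A V
  | sym x a, ρ, _ => look (ρ x) fun o _ => decide (o = some a)
  -- Two variables may share a head, but `compare` needs two different ones.
  | le x y, ρ, d => if ρ x = ρ y then setFlag (ρ x) true else compare (ρ x) (ρ y) (h d)
  | not φ, ρ, d => seq (program h φ ρ d) (look (h 0) fun _ b => !b)
  | and φ ψ, ρ, d => seq (program h φ ρ d) (ite (program h ψ ρ d) (skip (h 0)))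
  | cmp x φ ψ, ρ, d =>
    let ρ' := Function.update ρ x (h d)
    -- The head `h (d + 1)` counts up for `φ` and then down for `ψ`. As `dec` stops at 0, it ends at
    -- 0 exactly if the comparison holds. Otherwise `rewind` restores it and at the same time leaves
    -- the required flag `false`.
    seq (sweep (h d) (seq (program h φ ρ' (d + 2)) (ite (inc (h (d + 1))) (skip (h 0)))))
      (seq (sweep (h d) (seq (program h ψ ρ' (d + 2)) (ite (dec (h (d + 1))) (skip (h 0)))))
        (seq (back (h (d + 1)) fun o _ => o.isNone)
          (ite (skip (h 0)) (rewind (h (d + 1))))))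

/-- All heads return to their places, so subformulas can be evaluated one after another and once per
position of a sweep. The bound `P` is chosen before the string: each nested quantifier multiplies it
by a factor linear in the length. By `hD` and `hρ` the free heads are distinct and carry no
variable. -/
theorem execIn_program (h : ℕ → V) (D : ℕ) (hD : ∀ i < D, ∀ j < D, h i = h j → i = j)
    (φ : CountingFormula A) (ρ : ℕ → V) (d : ℕ) (hd : φ.heads d ≤ D)
    (hρ : ∀ x, ∀ i < D, d ≤ i → ρ x ≠ h i) :
    ∃ P : Polynomial ℕ, ∀ (T : List A) (b : Bool) (q : V → ℕ), (∀ v, q v ≤ T.length) →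
      (∀ i < D, d ≤ i → q (h i) = 0) →
      ExecIn T (program h φ ρ d) b q (φ.eval T (q ∘ ρ)) q (P.eval T.length) := by
  induction φ generalizing ρ d with
  | sym x a =>
    refine ⟨1, fun T b q hq hq0 => ?_⟩
    rw [Polynomial.eval_one]
    exact ExecIn.look (f := fun o _ => decide (o = some a))
  | le x y =>
    refine ⟨20 * (Polynomial.X + 1), fun T b q hq hq0 => ?_⟩
    simp only [heads] at hd
    simp only [program, eval, Function.comp_apply]
    simp only [Polynomial.eval_mul, Polynomial.eval_add, Polynomial.eval_X, Polynomial.eval_one,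
      Polynomial.eval_ofNat]
    split_ifs with hxy
    · rw [decide_eq_true (by rw [hxy])]
      exact execIn_setFlag.mono (by omega)
    · exact execIn_compare hxy (hρ _ _ hd le_rfl) (hρ _ _ hd le_rfl) hq (hq0 _ hd le_rfl)
  | not φ ih =>
    obtain ⟨P, hP⟩ := ih ρ d hd hρ
    refine ⟨P + 1, fun T b q hq hq0 => ?_⟩
    rw [Polynomial.eval_add, Polynomial.eval_one]
    exact (hP T b q hq hq0).seq (ExecIn.look (f := fun _ b => !b))
  | and φ ψ ih₁ ih₂ =>
    simp only [heads] at hd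
    obtain ⟨P, hP⟩ := ih₁ ρ d (by omega) hρ
    obtain ⟨Q, hQ⟩ := ih₂ ρ d (by omega) hρ
    refine ⟨P + (1 + (Q + 1)), fun T b q hq hq0 => ?_⟩
    simp only [Polynomial.eval_add, Polynomial.eval_one, eval]
    refine (hP T b q hq hq0).seq (.ite (fun h => ?_) fun h => ?_)
    · rw [h, Bool.true_and]
      exact (hQ T _ q hq hq0).mono (by omega)
    · rw [h, Bool.false_and]
      exact execIn_skip.mono (by omega)
  | cmp x φ ψ ih₁ ih₂ =>
    simp only [heads] at hd
    have hd' : d + 2 < D := (lt_heads φ (d + 2)).trans_le (by omega)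
    have hne : ∀ i < D, ∀ j < D, i ≠ j → h i ≠ h j := fun i hi j hj hij e => hij (hD i hi j hj e)
    have hρ' : ∀ y, ∀ i < D, d + 2 ≤ i → Function.update ρ x (h d) y ≠ h i := by
      intro y i hi hdi
      rcases eq_or_ne y x with rfl | hy
      · simpa using hne _ (by omega) _ hi (by omega)
      · simpa [hy] using hρ y i hi (by omega)
    obtain ⟨P, hP⟩ := ih₁ _ (d + 2) (by omega) hρ'
    obtain ⟨Q, hQ⟩ := ih₂ _ (d + 2) (by omega) hρ'
    refine ⟨((Polynomial.X + 1) * (2 * (P + (1 + 1) + 1) + 1) + (Polynomial.X + 1) * 3) +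
      (((Polynomial.X + 1) * (2 * (Q + (1 + 1) + 1) + 1) + (Polynomial.X + 1) * 3) +
      (1 + (1 + (Polynomial.X + 1) * 3))), fun T b q hq hq0 => ?_⟩
    simp only [Polynomial.eval_mul, Polynomial.eval_add, Polynomial.eval_X, Polynomial.eval_one,
      Polynomial.eval_ofNat, eval, program]
    -- The state with the counter at `k` and the sweeping head at `p`.
    let r : ℕ → ℕ → V → ℕ := fun k p =>
      Function.update (Function.update q (h (d + 1)) k) (h d) p
    have hdd : h d ≠ h (d + 1) := hne _ (by omega) _ (by omega) (by omega)
    have hr : ∀ k ≤ T.length, ∀ p ≤ T.length, ∀ v, r k p v ≤ T.length := by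
      intro k hk p hp v
      rcases eq_or_ne v (h d) with rfl | h₁
      · simpa [r] using hp
      rcases eq_or_ne v (h (d + 1)) with rfl | h₂
      · simpa [r, h₁] using hk
      simpa [r, h₁, h₂] using hq v
    have hr0 : ∀ k p, ∀ i < D, d + 2 ≤ i → r k p (h i) = 0 := by
      intro k p i hi hdi
      simp [r, hne i hi d (by omega) (by omega), hne i hi (d + 1) (by omega) (by omega),
        hq0 i hi (by omega)]
    have hre : ∀ k p, r k p ∘ Function.update ρ x (h d) = Function.update (q ∘ ρ) x p := by
      intro k p
      funext y
      rcases eq_or_ne y x with rfl | hy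
      · simp [r]
      · simp [r, hy, hρ y d (by omega) le_rfl, hρ y (d + 1) (by omega) (by omega)]
    have hrd : ∀ k p, r k p (h (d + 1)) = k := by
      intro k p
      simp [r, hdd.symm]
    have hrinc : ∀ k p k', Function.update (r k p) (h (d + 1)) k' = r k' p := by
      intro k p k'
      simp only [r]
      rw [Function.update_comm hdd, Function.update_idem]
    have hrx : ∀ k p p', Function.update (r k p) (h d) p' = r k p' := by
      intro k p p'
      simp [r]
    have hq00 : r 0 0 = q := by
      simp only [r]
      rw [Function.update_comm hdd.symm, Function.update_eq_self_iff.2,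
        Function.update_eq_self_iff.2 (hq0 d (by omega) le_rfl).symm]
      rw [Function.update_of_ne hdd.symm, hq0 (d + 1) (by omega) (by omega)]
    set m₁ := fun p => Nat.count (fun p => eval T φ (Function.update (q ∘ ρ) x p)) p with hm₁
    set m₂ := fun p => Nat.count (fun p => eval T ψ (Function.update (q ∘ ρ) x p)) p with hm₂
    -- The counter never overtakes the sweeping head, so `inc` is not clipped at the right end.
    have hm₁le : ∀ p, m₁ p ≤ p := fun p => Nat.count_le _
    have hs₁ := execIn_sweep (T := T) (x := h d) (b := b)
      (c := seq (program h φ (Function.update ρ x (h d)) (d + 2))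
        (HeadProgram.ite (inc (h (d + 1))) (skip (h 0))))
      (B := P.eval T.length + (1 + 1)) (fun p => r (m₁ p) p) (fun p _ => by simp [r])
      (fun p hp => ?_)
    · have hs₂ := execIn_sweep (T := T) (x := h d) (b := false)
        (c := seq (program h ψ (Function.update ρ x (h d)) (d + 2))
          (HeadProgram.ite (dec (h (d + 1))) (skip (h 0))))
        (B := Q.eval T.length + (1 + 1)) (fun p => r (m₁ T.length - m₂ p) p)
        (fun p _ => by simp [r]) (fun p hp => ?_)
      · simp only [hrx] at hs₁ hs₂
        simp only [hm₁, hm₂, Nat.count_zero, hq00, Nat.sub_zero] at hs₁ hs₂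
        refine hs₁.seq (hs₂.seq (ExecIn.seq ExecIn.back (.ite (fun h' => ?_) fun h' => ?_)))
        · rw [hrd, ← Option.not_isSome, isSome_getLast?_take
            ((Nat.sub_le _ _).trans (hm₁le _))] at h'
          simp only [Bool.not_eq_true', decide_eq_false_iff_not, hm₁] at h'
          rw [decide_eq_true (by omega), show Nat.count _ _ - Nat.count _ _ = 0 by omega, hq00]
          exact execIn_skip.mono (by omega)
        · rw [hrd, ← Option.not_isSome, isSome_getLast?_take
            ((Nat.sub_le _ _).trans (hm₁le _))] at h'
          simp only [Bool.not_eq_false', decide_eq_true_eq, hm₁] at h'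
          rw [decide_eq_false (by omega)]
          have := execIn_rewind (T := T) (x := h (d + 1)) (b := false)
            (q := r (m₁ T.length - m₂ T.length) 0)
            (by rw [hrd]; exact (Nat.sub_le _ _).trans (hm₁le _))
          rwa [hrinc, hq00] at this
      · have hle : m₁ T.length - m₂ p ≤ T.length := (Nat.sub_le _ _).trans (hm₁le _)
        have h₁ := hQ T true (r (m₁ T.length - m₂ p) p) (hr _ hle _ hp.le) (hr0 _ _)
        rw [hre] at h₁
        refine ⟨eval T ψ (Function.update (q ∘ ρ) x p), h₁.seq (.ite (fun h' => ?_) fun h' => ?_)⟩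
        · refine ⟨1, le_rfl, ?_⟩
          rw [hrx, h']
          apply Exec.dec_of_eq
          rw [hrd, hrinc, hm₂]
          simp only [Nat.count_succ, h', if_true, Nat.sub_sub]
        · rw [hrx, h']
          simp only [hm₂, Nat.count_succ, h', Bool.false_eq_true, if_false, add_zero]
          exact execIn_skip
    · have h₁ := hP T true (r (m₁ p) p) (hr _ ((hm₁le p).trans hp.le) _ hp.le) (hr0 _ _)
      rw [hre] at h₁
      refine ⟨eval T φ (Function.update (q ∘ ρ) x p), h₁.seq (.ite (fun h' => ?_) fun h' => ?_)⟩
      · refine ⟨1, le_rfl, ?_⟩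
        rw [hrx, h']
        apply Exec.inc_of_eq
        rw [hrd, hrinc, min_eq_left (by have := hm₁le p; omega)]
        simp only [hm₁, Nat.count_succ, h', if_true]
      · rw [hrx, h']
        simp only [hm₁, Nat.count_succ, h', Bool.false_eq_true, if_false, add_zero]
        exact execIn_skip

end CountingFormula

/-! ### Compilation to stack machines -/

/-- The stacks of the machine: input, output, and for each head `x` the part of the string to its
left and the part to its right. -/
inductive StackIndex (V : Type) : Type
  | input
  | output
  | left (x : V)
  | right (x : V)
  deriving DecidableEq, Fintype

/-- The stack symbols. The heads work on the input string followed by the end marker `none`. -/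
abbrev StackSymbol (Γ V : Type) : StackIndex V → Type
  | .input => Γ
  | .output => Bool
  | .left _ => Option Γ
  | .right _ => Option Γ

/-- The internal state: the symbol in transit, if any, and the flag. -/
abbrev ControlState (Γ : Type) : Type := Option (Option Γ) × Bool

/-- The contents of the stacks. -/
def stackContents {Γ V : Type} (i : List Γ) (o : List Bool) (L R : V → List (Option Γ)) :
    ∀ k, List (StackSymbol Γ V k)
  | .input => i
  | .output => o
  | .left x => L x
  | .right x => R x

section StackContents

variable {Γ V : Type} [DecidableEq V] (i : List Γ) (o : List Bool) (L R : V → List (Option Γ))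

theorem update_stackContents_input (i' : List Γ) :
    Function.update (stackContents i o L R) .input i' = stackContents i' o L R := by
  funext k
  cases k <;> simp [stackContents]

theorem update_stackContents_output (o' : List Bool) :
    Function.update (stackContents i o L R) .output o' = stackContents i o' L R := by
  funext k
  cases k <;> simp [stackContents]

theorem update_stackContents_left (x : V) (l : List (Option Γ)) :
    Function.update (stackContents i o L R) (.left x) l =
      stackContents i o (Function.update L x l) R := by
  funext k
  cases k with
  | left y =>
    rcases eq_or_ne y x with rfl | h
    · simp [stackContents]
    · simp [stackContents, h]
  | _ => simp [stackContents]

theorem update_stackContents_right (x : V) (l : List (Option Γ)) :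
    Function.update (stackContents i o L R) (.right x) l =
      stackContents i o L (Function.update R x l) := by
  funext k
  cases k with
  | right y =>
    rcases eq_or_ne y x with rfl | h
    · simp [stackContents]
    · simp [stackContents, h]
  | _ => simp [stackContents]

end StackContents

namespace HeadProgram

open Turing TM2.Stmt

/-- The labels of the compiled program. -/
def Label {A V : Type} : HeadProgram A V → Type
  | seq c d => Label c ⊕ Label d
  | ite c d => Option (Label c ⊕ Label d)
  | loop c d => Option (Label c ⊕ Label d)
  | inc _ => Unit
  | dec _ => Unit
  | look _ _ => Unit
  | back _ _ => Unit

/-- There are finitely many labels. -/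
noncomputable instance Label.fintype {A V : Type} : (c : HeadProgram A V) → Fintype (Label c)
  | seq c d =>
    haveI := Label.fintype c
    haveI := Label.fintype d
    inferInstanceAs (Fintype (Label c ⊕ Label d))
  | ite c d =>
    haveI := Label.fintype c
    haveI := Label.fintype d
    inferInstanceAs (Fintype (Option (Label c ⊕ Label d)))
  | loop c d =>
    haveI := Label.fintype c
    haveI := Label.fintype d
    inferInstanceAs (Fintype (Option (Label c ⊕ Label d)))
  | inc _ => inferInstanceAs (Fintype Unit)
  | dec _ => inferInstanceAs (Fintype Unit)
  | look _ _ => inferInstanceAs (Fintype Unit)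
  | back _ _ => inferInstanceAs (Fintype Unit)

/-- The label where the compiled program starts. -/
def entry {A V : Type} : (c : HeadProgram A V) → Label c
  | seq c _ => Sum.inl (entry c)
  | ite _ _ => (none : Option _)
  | loop c _ => some (Sum.inl (entry c))
  | inc _ => ()
  | dec _ => ()
  | look _ _ => ()
  | back _ _ => ()

variable {Γ V Λ : Type}

/-- Move the top symbol from one stack of a head to the other one, if there is any. -/
def moveStmt (x : V) (toLeft : Bool) (exit : Λ) :
    TM2.Stmt (StackSymbol Γ V) Λ (ControlState Γ) :=
  match toLeft with
  | true =>
    pop (.right x) (fun v o => (o, v.2)) (branch (fun v => v.1.isSome)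
      (push (.left x) (fun v => v.1.getD none) (load (fun v => (none, v.2)) (goto fun _ => exit)))
      (goto fun _ => exit))
  | false =>
    pop (.left x) (fun v o => (o, v.2)) (branch (fun v => v.1.isSome)
      (push (.right x) (fun v => v.1.getD none) (load (fun v => (none, v.2)) (goto fun _ => exit)))
      (goto fun _ => exit))

/-- The compiled program, with its labels embedded by `emb` and continuing at `exit`. -/
def code : (c : HeadProgram (Option Γ) V) → (Label c → Λ) → Λ → Label c →
    TM2.Stmt (StackSymbol Γ V) Λ (ControlState Γ)
  | inc x, _, exit => fun _ => moveStmt x true exit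
  | dec x, _, exit => fun _ => moveStmt x false exit
  | look x f, _, exit => fun _ =>
    peek (.right x) (fun v o => (none, f o v.2)) (goto fun _ => exit)
  | back x f, _, exit => fun _ =>
    peek (.left x) (fun v o => (none, f o v.2)) (goto fun _ => exit)
  | seq c d, emb, exit =>
    Sum.elim (code c (fun l => emb (Sum.inl l)) (emb (Sum.inr (entry d))))
      (code d (fun l => emb (Sum.inr l)) exit)
  | ite c d, emb, exit => fun o =>
    Option.elim (α := Label c ⊕ Label d) o
      (branch (fun v => v.2) (goto fun _ => emb (some (Sum.inl (entry c))))
        (goto fun _ => emb (some (Sum.inr (entry d)))))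
      (Sum.elim (code c (fun l => emb (some (Sum.inl l))) exit)
        (code d (fun l => emb (some (Sum.inr l))) exit))
  | loop c d, emb, exit => fun o =>
    Option.elim (α := Label c ⊕ Label d) o
      (branch (fun v => v.2) (goto fun _ => emb (some (Sum.inr (entry d)))) (goto fun _ => exit))
      (Sum.elim (code c (fun l => emb (some (Sum.inl l))) (emb (none : Option _)))
        (code d (fun l => emb (some (Sum.inr l))) (emb (some (Sum.inl (entry c))))))

/-- The machine configuration with given flag and head positions. -/
def config (T : List (Option Γ)) (l : Λ) (b : Bool) (q : V → ℕ) :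
    TM2.Cfg (StackSymbol Γ V) Λ (ControlState Γ) :=
  ⟨some l, (none, b),
    stackContents [] [] (fun x => (T.take (q x)).reverse) (fun x => T.drop (q x))⟩

/-! ### Correctness of the compiled program -/

variable [DecidableEq V]

/-- The machine `M` gets from one configuration to another one in `n` steps. -/
def ReachesIn (M : Λ → TM2.Stmt (StackSymbol Γ V) Λ (ControlState Γ)) (n : ℕ)
    (a b : TM2.Cfg (StackSymbol Γ V) Λ (ControlState Γ)) : Prop :=
  (flip bind (TM2.step M))^[n] (some a) = some b

variable {M : Λ → TM2.Stmt (StackSymbol Γ V) Λ (ControlState Γ)}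
  {a₁ a₂ a₃ : TM2.Cfg (StackSymbol Γ V) Λ (ControlState Γ)} {n₁ n₂ : ℕ}

theorem ReachesIn.trans (h₁ : ReachesIn M n₁ a₁ a₂) (h₂ : ReachesIn M n₂ a₂ a₃) :
    ReachesIn M (n₁ + n₂) a₁ a₃ := by
  unfold ReachesIn at *
  rw [add_comm, Function.iterate_add_apply, h₁, h₂]

theorem ReachesIn.single {l : Λ} {v : ControlState Γ} {S : ∀ k, List (StackSymbol Γ V k)}
    (h : TM2.stepAux (M l) v S = a₂) : ReachesIn M 1 ⟨some l, v, S⟩ a₂ := by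
  subst h
  rfl

theorem stepAux_moveStmt_left {T : List (Option Γ)} {x : V} {exit : Λ} {b : Bool} {q : V → ℕ}
    (hq : q x ≤ T.length) :
    TM2.stepAux (moveStmt x true exit) (none, b) (stackContents [] []
      (fun x => (T.take (q x)).reverse) (fun x => T.drop (q x))) =
      config T exit b (Function.update q x (min (q x + 1) T.length)) := by
  rcases hq.lt_or_eq with h | h
  · have hd : T.drop (q x) = T[q x] :: T.drop (q x + 1) := List.drop_eq_getElem_cons h
    simp only [moveStmt, TM2.stepAux, stackContents, hd, List.head?_cons, Option.isSome_some,
      cond_true, List.tail_cons, Option.getD_some, config]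
    rw [update_stackContents_right]
    simp only [stackContents]
    rw [update_stackContents_left, min_eq_left (by omega)]
    congr 2
    · funext y
      rcases eq_or_ne y x with rfl | hy
      · rw [Function.update_self, Function.update_self, List.take_add_one,
          List.getElem?_eq_getElem h]
        simp only [Option.toList_some, List.reverse_append, List.reverse_cons, List.reverse_nil,
          List.nil_append, List.cons_append]
      · simp [hy]
    · funext y
      rcases eq_or_ne y x with rfl | hy
      · simp
      · simp [hy]
  · have hd : T.drop (q x) = [] := by simp [h]
    simp only [moveStmt, TM2.stepAux, stackContents, hd, List.head?_nil, Option.isSome_none,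
      cond_false, List.tail_nil, config]
    have e : Function.update (fun x => T.drop (q x)) x [] = fun x => T.drop (q x) := by
      rw [← hd]
      exact Function.update_eq_self x _
    rw [update_stackContents_right, min_eq_right (by omega), ← h, Function.update_eq_self, e]

theorem stepAux_moveStmt_right {T : List (Option Γ)} {x : V} {exit : Λ} {b : Bool} {q : V → ℕ}
    (hq : q x ≤ T.length) :
    TM2.stepAux (moveStmt x false exit) (none, b) (stackContents [] []
      (fun x => (T.take (q x)).reverse) (fun x => T.drop (q x))) =
      config T exit b (Function.update q x (q x - 1)) := by
  rcases Nat.eq_zero_or_pos (q x) with h | h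
  · have hd : (T.take (q x)).reverse = [] := by simp [h]
    simp only [moveStmt, TM2.stepAux, stackContents, hd, List.head?_nil, Option.isSome_none,
      cond_false, List.tail_nil, config]
    have e : Function.update (fun x => (T.take (q x)).reverse) x [] =
        fun x => (T.take (q x)).reverse := by
      rw [← hd]
      exact Function.update_eq_self x _
    have e' : Function.update q x (q x - 1) = q := by
      rw [Function.update_eq_self_iff]
      omega
    rw [update_stackContents_left, e', e]
  · obtain ⟨n, hn⟩ : ∃ n, q x = n + 1 := ⟨q x - 1, by omega⟩
    have hd : (T.take (q x)).reverse = T[n] :: (T.take n).reverse := by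
      rw [hn, List.take_add_one]
      simp [show n < T.length by omega]
    simp only [moveStmt, TM2.stepAux, stackContents, hd, List.head?_cons, Option.isSome_some,
      cond_true, List.tail_cons, Option.getD_some, config]
    rw [update_stackContents_left]
    simp only [stackContents]
    rw [update_stackContents_right, hn, Nat.add_sub_cancel]
    congr 2
    · funext y
      rcases eq_or_ne y x with rfl | hy
      · simp
      · simp [hy]
    · funext y
      rcases eq_or_ne y x with rfl | hy
      · simp
      · simp [hy]

/-- The step counts agree exactly: every basic instruction is one statement, and the extra label
`none` of `ite` and `loop` performs the test for which `Exec` charges one step. The embedding of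
labels and the exit vary because a subprogram sits inside a larger one and continues there. -/
theorem reachesIn_code {T : List (Option Γ)} {c : HeadProgram (Option Γ) V} {b b' : Bool}
    {q q' : V → ℕ} {n : ℕ} (h : Exec T c b q b' q' n) (hq : ∀ x, q x ≤ T.length)
    (emb : Label c → Λ) (exit : Λ) (hM : ∀ l, M (emb l) = code c emb exit l) :
    ReachesIn M n (config T (emb (entry c)) b q) (config T exit b' q') := by
  induction h generalizing exit with
  | inc =>
    refine ReachesIn.single ?_
    rw [hM]
    exact stepAux_moveStmt_left (hq _)
  | dec =>
    refine ReachesIn.single ?_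
    rw [hM]
    exact stepAux_moveStmt_right (hq _)
  | look =>
    refine ReachesIn.single ?_
    rw [hM]
    simp [code, config, stackContents]
  | back =>
    refine ReachesIn.single ?_
    rw [hM]
    simp [code, config, stackContents]
  | seq h₁ h₂ ih₁ ih₂ =>
    exact (ih₁ hq _ _ fun l => hM (Sum.inl l)).trans
      (ih₂ (h₁.pos_le hq) _ _ fun l => hM (Sum.inr l))
  | ite_true h ih =>
    refine ReachesIn.trans (ReachesIn.single ?_) (ih hq _ _ fun l => hM (some (Sum.inl l)))
    rw [hM]
    rfl
  | ite_false h ih =>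
    refine ReachesIn.trans (ReachesIn.single ?_) (ih hq _ _ fun l => hM (some (Sum.inr l)))
    rw [hM]
    rfl
  | loop_exit h ih =>
    refine (ih hq _ _ fun l => hM (some (Sum.inl l))).trans (ReachesIn.single ?_)
    exact (congrArg (fun s => TM2.stepAux s _ _) (hM (none : Option (Label _ ⊕ Label _)))).trans rfl
  | loop_step h₁ h₂ h₃ ih₁ ih₂ ih₃ =>
    have hq₁ := h₁.pos_le hq
    refine (((ih₁ hq _ _ fun l => hM (some (Sum.inl l))).trans (ReachesIn.single ?_)).trans
      (ih₂ hq₁ _ _ fun l => hM (some (Sum.inr l)))).trans (ih₃ (h₂.pos_le hq₁) emb exit hM)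
    exact (congrArg (fun s => TM2.stepAux s _ _) (hM (none : Option (Label _ ⊕ Label _)))).trans rfl

/-- Move all heads in a list to the left end. -/
def rewindAll (x₀ : V) : List V → HeadProgram (Option Γ) V
  | [] => skip x₀
  | x :: l => seq (rewind x) (rewindAll x₀ l)

theorem execIn_rewindAll (T : List (Option Γ)) (x₀ : V) (l : List V) (b : Bool) (q : V → ℕ)
    (hq : ∀ x, q x ≤ T.length) :
    ∃ b', ExecIn T (rewindAll x₀ l) b q b' (fun x => if x ∈ l then 0 else q x)
      (l.length * ((T.length + 1) * 3) + 1) := by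
  induction l generalizing b q with
  | nil => exact ⟨b, by simpa [rewindAll] using execIn_skip⟩
  | cons x l ih =>
    obtain ⟨b', h⟩ := ih false (Function.update q x 0) (fun y => by
      rcases eq_or_ne y x with rfl | hy
      · simp
      · simpa [hy] using hq y)
    refine ⟨b', ?_⟩
    have h' := (execIn_rewind (b := b) (hq x)).seq h
    have e : (fun y => if y ∈ l then 0 else Function.update q x 0 y) =
        fun y => if y ∈ x :: l then 0 else q y := by
      funext y
      rcases eq_or_ne y x with rfl | hy
      · simp
      · simp [hy]
    rw [e] at h'
    refine h'.mono ?_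
    rw [List.length_cons, Nat.succ_mul]
    exact le_of_eq (by ring)

/-- Push the symbol in transit on the left stacks of all heads in a list. -/
def pushAll (q : TM2.Stmt (StackSymbol Γ V) Λ (ControlState Γ)) :
    List V → TM2.Stmt (StackSymbol Γ V) Λ (ControlState Γ)
  | [] => q
  | x :: l => push (.left x) (fun v => v.1.getD none) (pushAll q l)

/-- Pop the right stacks of all heads in a list. -/
def popAll (q : TM2.Stmt (StackSymbol Γ V) Λ (ControlState Γ)) :
    List V → TM2.Stmt (StackSymbol Γ V) Λ (ControlState Γ)
  | [] => q
  | x :: l => pop (.right x) (fun v _ => v) (popAll q l)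

theorem stepAux_pushAll (s : TM2.Stmt (StackSymbol Γ V) Λ (ControlState Γ)) (l : List V)
    (hl : l.Nodup) (v : ControlState Γ) (i : List Γ) (o : List Bool) (L R : V → List (Option Γ)) :
    TM2.stepAux (pushAll s l) v (stackContents i o L R) = TM2.stepAux s v (stackContents i o
      (fun x => if x ∈ l then v.1.getD none :: L x else L x) R) := by
  induction l generalizing L with
  | nil => simp [pushAll]
  | cons x l ih =>
    rw [List.nodup_cons] at hl
    simp only [pushAll, TM2.stepAux]
    rw [update_stackContents_left, ih hl.2]
    congr 2
    funext y
    rcases eq_or_ne y x with rfl | hy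
    · simp [hl.1, stackContents]
    · simp [hy]

theorem stepAux_popAll (s : TM2.Stmt (StackSymbol Γ V) Λ (ControlState Γ)) (l : List V)
    (hl : l.Nodup) (v : ControlState Γ) (i : List Γ) (o : List Bool) (L R : V → List (Option Γ)) :
    TM2.stepAux (popAll s l) v (stackContents i o L R) = TM2.stepAux s v (stackContents i o
      L (fun x => if x ∈ l then (R x).tail else R x)) := by
  induction l generalizing R with
  | nil => simp [popAll]
  | cons x l ih =>
    rw [List.nodup_cons] at hl
    simp only [popAll, TM2.stepAux]
    rw [update_stackContents_right, ih hl.2]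
    congr 2
    funext y
    rcases eq_or_ne y x with rfl | hy
    · simp [hl.1, stackContents]
    · simp [hy]

/-- The labels of the machine that copies the input to all heads, runs the program, and clears its
stacks. -/
inductive MachineLabel (c : HeadProgram (Option Γ) V) : Type
  | copy
  | run (l : Label c)
  | clear

noncomputable instance MachineLabel.fintype (c : HeadProgram (Option Γ) V) :
    Fintype (MachineLabel c) :=
  Fintype.ofEquiv (Option (Option (Label c)))
    { toFun := fun o => o.elim .copy fun o => o.elim .clear .run
      invFun := fun l => match l with
        | .copy => none
        | .clear => some none
        | .run l => some (some l)
      left_inv := by rintro (_ | _ | _) <;> rfl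
      right_inv := by rintro (_ | _ | _) <;> rfl }

/-- The statements of the machine that copies the input to all heads, runs the program, and clears
its stacks. -/
noncomputable def machineStmt [Fintype V] (c : HeadProgram (Option Γ) V) (x₀ : V) :
    MachineLabel c → TM2.Stmt (StackSymbol Γ V) (MachineLabel c) (ControlState Γ)
  | .copy =>
    -- When the input is exhausted, the symbol in transit is `none`, and `pushAll` then pushes the
    -- end marker before the branch leaves the copying phase.
    pop .input (fun v o => (o.map some, v.2)) (pushAll
      (branch (fun v => v.1.isSome) (load (fun v => (none, v.2)) (goto fun _ => .copy))
        (goto fun _ => .run (entry c))) (Finset.univ : Finset V).toList)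
  | .run l => code c .run .clear l
  | .clear =>
    -- All heads are at the left end by now, so the right stacks have equal contents and looking at
    -- one of them suffices. The final `load` restores the initial internal state, as `haltList`
    -- demands.
    peek (.right x₀) (fun v o => (o, v.2)) (popAll
      (branch (fun v => v.1.isSome) (load (fun v => (none, v.2)) (goto fun _ => .clear))
        (push .output (fun v => v.2) (load (fun _ => (none, false)) halt)))
      (Finset.univ : Finset V).toList)

/-- The machine that copies the input to all heads, runs the program, and clears its stacks. -/
noncomputable def machine [Fintype Γ] [Fintype V] (c : HeadProgram (Option Γ) V) (x₀ : V) :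
    FinTM2 where
  K := StackIndex V
  k₀ := .input
  k₁ := .output
  Γ := StackSymbol Γ V
  Λ := MachineLabel c
  main := .copy
  σ := ControlState Γ
  initialState := (none, false)
  Γk₀Fin := inferInstanceAs (Fintype Γ)
  m := machineStmt c x₀

/-! ### The complete machine -/

variable [Fintype V]

/-- The list `t` is what has been read already. One step is spent on each symbol and one on the end
marker. Copying leaves every head at the right end, which is what `rewindAll` repairs. -/
theorem reachesIn_copy (c : HeadProgram (Option Γ) V) (x₀ : V) (i : List Γ)
    (t : List (Option Γ)) :
    ReachesIn (machineStmt c x₀) (i.length + 1)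
      ⟨some .copy, (none, false), stackContents i [] (fun _ => t.reverse) fun _ => []⟩
      ⟨some (.run (entry c)), (none, false),
        stackContents [] [] (fun _ => (t ++ (i.map some ++ [none])).reverse) fun _ => []⟩ := by
  induction i generalizing t with
  | nil =>
    refine ReachesIn.single ?_
    simp only [machineStmt, TM2.stepAux]
    rw [update_stackContents_input, stepAux_pushAll _ _ (Finset.nodup_toList _)]
    simp [stackContents]
  | cons a i ih =>
    rw [List.length_cons, add_comm (i.length + 1)]
    have h := ih (t ++ [some a])
    rw [List.append_assoc, List.singleton_append, ← List.cons_append, ← List.map_cons] at h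
    refine ReachesIn.trans (ReachesIn.single ?_) h
    · simp only [machineStmt, TM2.stepAux]
      rw [update_stackContents_input, stepAux_pushAll _ _ (Finset.nodup_toList _)]
      simp [stackContents]

theorem reachesIn_clear (c : HeadProgram (Option Γ) V) (x₀ : V) (b : Bool)
    (t : List (Option Γ)) :
    ReachesIn (machineStmt c x₀) (t.length + 1)
      ⟨some .clear, (none, b), stackContents [] [] (fun _ => []) fun _ => t⟩
      ⟨none, (none, false), stackContents [] [b] (fun _ => []) fun _ => []⟩ := by
  induction t with
  | nil =>
    refine ReachesIn.single ?_
    simp only [machineStmt, TM2.stepAux]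
    rw [stepAux_popAll _ _ (Finset.nodup_toList _)]
    simp [stackContents]
    rw [update_stackContents_output]
  | cons a t ih =>
    rw [List.length_cons, add_comm (t.length + 1)]
    refine ReachesIn.trans (ReachesIn.single ?_) ih
    simp only [machineStmt, TM2.stepAux]
    rw [stepAux_popAll _ _ (Finset.nodup_toList _)]
    simp [stackContents]

end HeadProgram

open HeadProgram Turing in
/-- A problem that is expressed by a counting formula over the input string followed by an end
marker is polynomial-time solvable. -/
theorem polyTimeSolvable_of_countingFormula {α Γ : Type} [Fintype Γ] [DecidableEq Γ]
    (enc : α → List Γ) (P : α → Prop) (φ : CountingFormula (Option Γ))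
    (h : ∀ a, φ.eval ((enc a).map some ++ [none]) (fun _ => 0) = true ↔ P a) :
    PolyTimeSolvable enc P := by
  refine ⟨fun a => φ.eval ((enc a).map some ++ [none]) fun _ => 0, h, ?_⟩
  set D := φ.heads 1 with hD
  have hD0 : 0 < D := (Nat.zero_lt_one.trans (φ.lt_heads 1))
  let x₀ : Fin D := ⟨0, hD0⟩
  let hd : ℕ → Fin D := fun i => if hi : i < D then ⟨i, hi⟩ else x₀
  -- All variables start on the head `x₀ = hd 0` at position 0, so the heads from 1 on are free.
  obtain ⟨Q, hQ⟩ := CountingFormula.execIn_program hd D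
    (fun i hi j hj hij => by simpa [hd, hi, hj] using hij) φ (fun _ => x₀) 1 le_rfl
    (fun _ i hi hi1 => by simp only [hd, hi, x₀, dif_pos, ne_eq, Fin.mk.injEq]; omega)
  set c : HeadProgram (Option Γ) (Fin D) :=
    seq (rewindAll x₀ Finset.univ.toList) (φ.program hd (fun _ => x₀) 1) with hc
  -- Copying, then rewinding and evaluating, then clearing; with the end marker the string has
  -- length `X + 1`.
  let time : Polynomial ℕ :=
    (Polynomial.X + 1) + (Polynomial.C D * ((Polynomial.X + 1 + 1) * 3) + 1 +
      Q.comp (Polynomial.X + 1)) + (Polynomial.X + 1 + 1)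
  have key : ∀ a, ∃ n ≤ time.eval (enc a).length, (flip bind (machine c x₀).step)^[n]
      (some (initList (machine c x₀) (enc a))) = some (haltList (machine c x₀)
        [φ.eval ((enc a).map some ++ [none]) fun _ => 0]) := by
    intro a
    set T := (enc a).map some ++ [none] with hT
    have hTl : T.length = (enc a).length + 1 := by simp [hT]
    obtain ⟨b', hr⟩ := execIn_rewindAll T x₀ Finset.univ.toList false (fun _ => T.length)
      (fun _ => le_rfl)
    simp only [Finset.mem_toList, Finset.mem_univ, if_true, Finset.length_toList,
      Finset.card_univ, Fintype.card_fin] at hr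
    obtain ⟨n, hn, hrun⟩ := hr.seq (hQ T b' (fun _ => 0) (fun _ => Nat.zero_le _) fun _ _ _ => rfl)
    have h₁ := reachesIn_copy c x₀ (enc a) []
    have h₂ := reachesIn_code (M := machineStmt c x₀) hrun (fun _ => le_rfl) .run .clear
      (fun _ => rfl)
    have h₃ := reachesIn_clear c x₀ (φ.eval T fun _ => 0) T
    simp only [config, List.take_length, List.drop_length, List.take_zero, List.drop_zero,
      List.reverse_nil] at h₂
    simp only [List.nil_append, ← hT, List.reverse_nil] at h₁
    have e₁ : initList (machine c x₀) (enc a) = (⟨some .copy, (none, false),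
        stackContents (enc a) [] (fun _ => []) fun _ => []⟩ :
        TM2.Cfg (StackSymbol Γ (Fin D)) (MachineLabel c) (ControlState Γ)) := by
      unfold initList
      congr 1
      funext k
      cases k <;> rfl
    have e₂ : haltList (machine c x₀) [φ.eval T fun _ => 0] = (⟨none, (none, false),
        stackContents [] [φ.eval T fun _ => 0] (fun _ => []) fun _ => []⟩ :
        TM2.Cfg (StackSymbol Γ (Fin D)) (MachineLabel c) (ControlState Γ)) := by
      unfold haltList
      congr 1
      funext k
      cases k <;> rfl
    refine ⟨(enc a).length + 1 + n + (T.length + 1), ?_, ?_⟩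
    · simp only [time, Polynomial.eval_add, Polynomial.eval_mul, Polynomial.eval_X,
        Polynomial.eval_one, Polynomial.eval_C, Polynomial.eval_ofNat, Polynomial.eval_comp]
      rw [hTl] at hn ⊢
      omega
    · rw [e₁, e₂]
      exact (h₁.trans h₂).trans h₃
  choose n hn hrun using key
  refine ⟨⟨⟨machine c x₀, Equiv.refl _, Equiv.refl _⟩, time, fun a => ⟨⟨n a, ?_⟩, hn a⟩⟩⟩
  have e : (enc a).map (Equiv.refl Γ).invFun = enc a := List.map_id _
  exact (congrArg (fun l => (flip bind (machine c x₀).step)^[n a]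
    (some (initList (machine c x₀) l))) e).trans (hrun a)

/-! ### Committees of maximum total score -/

section TopCommittees

open Finset

variable {C : Type}

/-- Take the largest `θ ≤ B` that at least `k` candidates reach. If `θ < B`, fewer than `k`
candidates reach `θ + 1`; if `θ = B`, nobody exceeds it. -/
theorem exists_threshold [Fintype C] (S : C → ℕ) (k B : ℕ) (hk : k ≤ Fintype.card C)
    (hB : ∀ c, S c ≤ B) :
    ∃ θ ≤ B, (univ.filter fun c => θ < S c).card ≤ k ∧
      k ≤ (univ.filter fun c => θ ≤ S c).card := by
  let P : ℕ → Prop := fun θ => k ≤ (univ.filter fun c => θ ≤ S c).card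
  have h0 : P 0 := by simpa [P] using hk
  refine ⟨Nat.findGreatest P B, Nat.findGreatest_le B, ?_,
    Nat.findGreatest_spec (Nat.zero_le B) h0⟩
  rcases (Nat.findGreatest_le (P := P) B).lt_or_eq with h | h
  · have := Nat.findGreatest_is_greatest (P := P) (Nat.lt_succ_self _) h
    exact (not_le.1 this).le
  · rw [h, filter_false_of_mem fun c _ => not_lt.2 (hB c)]
    simp

/-- The committee `y` has the maximum total score among all `k`-committees. -/
def IsTopCommittee (S : C → ℕ) (k : ℕ) (y : Finset C) : Prop :=
  y.card = k ∧ ∀ y' : Finset C, y'.card = k → ∑ c ∈ y', S c ≤ ∑ c ∈ y, S c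

theorem isTopCommittee_map_iff (S : C → ℕ) (k : ℕ) (y : Finset C) (π : Equiv.Perm C) :
    IsTopCommittee S k (y.map π.toEmbedding) ↔ IsTopCommittee (fun c => S (π c)) k y := by
  simp only [IsTopCommittee, card_map, sum_map, Equiv.coe_toEmbedding]
  refine and_congr_right fun _ => ⟨fun h y' hy' => ?_, fun h y' hy' => ?_⟩
  · simpa using h (y'.map π.toEmbedding) (by simpa using hy')
  · simpa using h (y'.map π.symm.toEmbedding) (by simpa using hy')

theorem exists_isTopCommittee [Fintype C] (S : C → ℕ) (k : ℕ) (hk : k ≤ Fintype.card C) :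
    ∃ y, IsTopCommittee S k y := by
  obtain ⟨y, hy, h⟩ := exists_max_image (powersetCard k (univ : Finset C)) (fun y => ∑ c ∈ y, S c)
    (powersetCard_nonempty.2 (by simpa using hk))
  simp only [mem_powersetCard_univ] at hy h
  exact ⟨y, hy, h⟩

variable [DecidableEq C]

theorem avScore_eq_sum (V : Multiset (Finset C)) (w : Finset C) :
    avScore V w = ∑ c ∈ w, V.countP (c ∈ ·) := by
  unfold avScore
  induction V using Multiset.induction_on with
  | empty => simp
  | cons v V ih =>
    simp only [Multiset.map_cons, Multiset.sum_cons, ih, Multiset.countP_cons,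
      Finset.sum_add_distrib]
    rw [add_comm, Finset.inter_comm, ← Finset.filter_mem_eq_inter, Finset.card_filter]

theorem mem_AV_iff_isTopCommittee (V : Multiset (Finset C)) (k : ℕ) (y : Finset C) :
    y ∈ AV V k ↔ IsTopCommittee (fun c => V.countP (c ∈ ·)) k y := by
  simp only [AV, Set.mem_ofPred_eq, IsTopCommittee, avScore_eq_sum]

/-- In passing from `S` to `S'` the set `x` gains at least as much as any `y`: they share `x ∩ y`,
the scores do not fall on `x \ y`, and they do not rise on `y \ x`. Additive form avoids subtraction
in `ℕ`. -/
theorem sum_add_sum_le_of_le_on {S S' : C → ℕ} {x : Finset C} (h₁ : ∀ c ∈ x, S c ≤ S' c)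
    (h₂ : ∀ c ∉ x, S' c ≤ S c) (y : Finset C) :
    ∑ c ∈ y, S' c + ∑ c ∈ x, S c ≤ ∑ c ∈ x, S' c + ∑ c ∈ y, S c := by
  rw [← sum_inter_add_sum_sdiff y x S', ← sum_inter_add_sum_sdiff y x S,
    ← sum_inter_add_sum_sdiff x y S', ← sum_inter_add_sum_sdiff x y S, inter_comm x y]
  have e₁ : ∑ c ∈ x \ y, S c ≤ ∑ c ∈ x \ y, S' c :=
    sum_le_sum fun c hc => h₁ c (mem_sdiff.1 hc).1
  have e₂ : ∑ c ∈ y \ x, S' c ≤ ∑ c ∈ y \ x, S c :=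
    sum_le_sum fun c hc => h₂ c (mem_sdiff.1 hc).2
  omega

/-- A top committee remains one if its members gain and the other candidates lose. -/
theorem IsTopCommittee.of_le_on {S S' : C → ℕ} {k : ℕ} {x : Finset C} (hx : IsTopCommittee S k x)
    (h₁ : ∀ c ∈ x, S c ≤ S' c) (h₂ : ∀ c ∉ x, S' c ≤ S c) : IsTopCommittee S' k x :=
  ⟨hx.1, fun y hy => by
    have := sum_add_sum_le_of_le_on h₁ h₂ y
    have := hx.2 y hy
    omega⟩

/-- No new top committees arise if the members of a top committee gain and the other candidates
lose. -/
theorem IsTopCommittee.of_isTopCommittee_of_le_on {S S' : C → ℕ} {k : ℕ} {x y : Finset C}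
    (hx : IsTopCommittee S k x) (h₁ : ∀ c ∈ x, S c ≤ S' c) (h₂ : ∀ c ∉ x, S' c ≤ S c)
    (hy : IsTopCommittee S' k y) : IsTopCommittee S k y :=
  ⟨hy.1, fun y' hy' => by
    have := sum_add_sum_le_of_le_on h₁ h₂ y
    have := hx.2 y' hy'
    have := hy.2 x hx.1
    omega⟩

/-- Otherwise exchanging `d` for `c` would increase the total score. -/
theorem IsTopCommittee.le_of_mem_of_notMem {S : C → ℕ} {k : ℕ} {y : Finset C}
    (hy : IsTopCommittee S k y) {c d : C}
    (hd : d ∈ y) (hc : c ∉ y) : S c ≤ S d := by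
  have hce : c ∉ y.erase d := fun h => hc (mem_of_mem_erase h)
  have := hy.2 (insert c (y.erase d)) (by
    rw [card_insert_of_notMem hce, card_erase_add_one hd, hy.1])
  rw [sum_insert hce, ← add_sum_erase _ _ hd] at this
  omega

/-- If at most `k` candidates exceed the threshold and at least `k` candidates reach it, then the
top committees contain all candidates of the first kind and only ones of the second kind. -/
theorem isTopCommittee_iff_of_threshold [Fintype C] {S : C → ℕ} {k θ : ℕ}
    (h₁ : (univ.filter fun c => θ < S c).card ≤ k) (h₂ : k ≤ (univ.filter fun c => θ ≤ S c).card)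
    (y : Finset C) :
    IsTopCommittee S k y ↔
      y.card = k ∧ (univ.filter fun c => θ < S c) ⊆ y ∧ y ⊆ univ.filter fun c => θ ≤ S c := by
  constructor
  · refine fun hy => ⟨hy.1, fun c hc => ?_, fun c hc => ?_⟩
    · by_contra hcy
      -- If all members of `y` exceeded the threshold, then `y` would be a proper subset of a set of
      -- size at most `k`. The member `d` found here has a lower score than the excluded `c`,
      -- against optimality.
      have : ∃ d ∈ y, d ∉ univ.filter fun c => θ < S c := by
        by_contra! h
        have := card_lt_card (Finset.ssubset_iff_subset_ne.2 ⟨h, fun e => hcy (e ▸ hc)⟩)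
        have := hy.1
        omega
      obtain ⟨d, hd, hdF⟩ := this
      have := hy.le_of_mem_of_notMem hd hcy
      simp only [mem_filter, mem_univ, true_and] at hc hdF
      omega
    · by_contra hcG
      have : ∃ d ∈ univ.filter (fun c => θ ≤ S c), d ∉ y := by
        by_contra! h
        have := card_lt_card (Finset.ssubset_iff_subset_ne.2 ⟨h, fun e => hcG (e ▸ hc)⟩)
        have := hy.1
        omega
      obtain ⟨d, hdG, hd⟩ := this
      have := hy.le_of_mem_of_notMem hc hd
      simp only [mem_filter, mem_univ, true_and] at hcG hdG
      omega
  · rintro ⟨hk, hF, hG⟩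
    refine ⟨hk, fun y' hy' => ?_⟩
    -- Only the differences matter. They have equal size, and `θ` bounds the scores from above on
    -- `y' \ y` and from below on `y \ y'`.
    rw [← sum_inter_add_sum_sdiff y' y, ← sum_inter_add_sum_sdiff y y', inter_comm y y']
    have hcard : (y' \ y).card = (y \ y').card := by
      have e₁ := card_inter_add_card_sdiff y y'
      have e₂ := card_inter_add_card_sdiff y' y
      rw [inter_comm] at e₂
      omega
    have e₁ : ∑ c ∈ y' \ y, S c ≤ (y' \ y).card * θ := by
      refine sum_le_card_nsmul _ _ _ fun c hc => ?_
      by_contra! h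
      exact (mem_sdiff.1 hc).2 (hF (by simpa using h))
    have e₂ : (y \ y').card * θ ≤ ∑ c ∈ y \ y', S c := by
      refine card_nsmul_le_sum _ _ _ fun c hc => ?_
      simpa using hG (mem_sdiff.1 hc).1
    rw [hcard] at e₁
    omega

/-- The least number of elements of `A` in a `k`-element set between `F` and `G`. -/
theorem forall_le_card_inter_iff {F G : Finset C} {k : ℕ} (hFG : F ⊆ G) (hF : F.card ≤ k)
    (hG : k ≤ G.card) (A : Finset C) (n : ℕ) :
    (∀ y : Finset C, y.card = k → F ⊆ y → y ⊆ G → n ≤ (A ∩ y).card) ↔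
      n ≤ (F ∩ A).card ∨ n + (G \ A).card ≤ k := by
  constructor
  · intro h
    -- To have few elements of `A`, start with `F` and fill up from `G \ A` first. If this suffices,
    -- all elements of `A` in `y` come from `F`; if not, `y` contains all of `G \ A`.
    rcases le_total k (F ∪ (G \ A)).card with hB | hB
    · obtain ⟨y, h₁, h₂, h₃⟩ := exists_subsuperset_card_eq
        (subset_union_left : F ⊆ F ∪ (G \ A)) hF hB
      refine .inl ((h y h₃ h₁ (h₂.trans (union_subset hFG sdiff_subset))).trans
        (card_le_card fun c hc => ?_))
      rw [mem_inter] at hc ⊢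
      have := h₂ hc.2
      rw [mem_union, mem_sdiff] at this
      tauto
    · obtain ⟨y, h₁, h₂, h₃⟩ := exists_subsuperset_card_eq
        (union_subset hFG (sdiff_subset : G \ A ⊆ G)) hB hG
      have h' := h y h₃ (subset_union_left.trans h₁) h₂
      have e := card_inter_add_card_sdiff y A
      rw [inter_comm] at e
      have : (G \ A).card ≤ (y \ A).card := card_le_card fun c hc =>
        mem_sdiff.2 ⟨h₁ (mem_union_right _ hc), (mem_sdiff.1 hc).2⟩
      exact .inr (by omega)
  · rintro (h | h) y hy hFy hyG
    · refine h.trans (card_le_card ?_)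
      rw [inter_comm A]
      exact inter_subset_inter_right hFy
    · have e := card_inter_add_card_sdiff y A
      rw [inter_comm] at e
      have : (y \ A).card ≤ (G \ A).card := card_le_card (sdiff_subset_sdiff hyG subset_rfl)
      omega

end TopCommittees

/-! ### Coalition manipulation of approval voting -/

section Manipulation

open Finset

variable {C : Type}

/-- An upward closed set is given by one least element for each type. -/
theorem exists_cuts {τ : Type} [DecidableEq τ] (type : C → τ) (rank : C → ℕ)
    (hinj : Function.Injective rank) (x : Finset C)
    (hx : ∀ c ∈ x, ∀ d, type c = type d → rank c < rank d → d ∈ x) :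
    ∃ z : τ → Option C, ∀ c, c ∈ x ↔ ∃ j, ∃ a ∈ z j, type c = type a ∧ rank a ≤ rank c := by
  have h : ∀ j, ∃ o : Option C, (∀ a ∈ o, a ∈ x) ∧
      ∀ c ∈ x, type c = j → ∃ a ∈ o, type c = type a ∧ rank a ≤ rank c := by
    intro j
    rcases (x.filter fun c => type c = j).eq_empty_or_nonempty with h | h
    · refine ⟨none, by simp, fun c hc hj => ?_⟩
      have : c ∈ x.filter fun c => type c = j := by simp [hc, hj]
      simp [h] at this
    · obtain ⟨a, ha, hmin⟩ := exists_min_image _ rank h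
      simp only [mem_filter] at ha hmin
      exact ⟨some a, by simpa using ha.1, fun c hc hj =>
        ⟨a, rfl, by rw [hj, ha.2], hmin c ⟨hc, hj⟩⟩⟩
  choose z hz₁ hz₂ using h
  refine ⟨z, fun c => ⟨fun hc => ⟨type c, hz₂ _ c hc rfl⟩, ?_⟩⟩
  rintro ⟨j, a, ha, hty, hle⟩
  rcases hle.lt_or_eq with h | h
  · exact hx a (hz₁ j a ha) c hty.symm h
  · exact hinj h ▸ hz₁ j a ha

variable [DecidableEq C]

/-- The scores if `n` votes for the members of `x` are added. -/
def boost (s : C → ℕ) (n : ℕ) (x : Finset C) (c : C) : ℕ := s c + if c ∈ x then n else 0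

theorem countP_add_replicate (V : Multiset (Finset C)) (n : ℕ) (x : Finset C) :
    (fun c => (V + Multiset.replicate n x).countP (c ∈ ·)) =
      boost (fun c => V.countP (c ∈ ·)) n x := by
  funext c
  rw [Multiset.countP_add, boost]
  split_ifs with h
  · have : (Multiset.replicate n x).countP (c ∈ ·) = (Multiset.replicate n x).card :=
      Multiset.countP_eq_card.2 fun a ha => (Multiset.eq_of_mem_replicate ha).symm ▸ h
    rw [this, Multiset.card_replicate]
  · have : (Multiset.replicate n x).countP (c ∈ ·) = 0 :=
      Multiset.countP_eq_zero.2 fun a ha => (Multiset.eq_of_mem_replicate ha).symm ▸ h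
    rw [this]

/-- The manipulators may all approve the members of one new winning committee only. -/
theorem exists_votes_iff [Fintype C] (V : Multiset (Finset C)) (n k : ℕ)
    (hk : k ≤ Fintype.card C) (Q : Finset C → Prop) :
    (∃ U : Multiset (Finset C), U.card = n ∧ ∀ y ∈ AV (V + U) k, Q y) ↔
      ∃ x, IsTopCommittee (boost (fun c => V.countP (c ∈ ·)) n x) k x ∧
        ∀ y, IsTopCommittee (boost (fun c => V.countP (c ∈ ·)) n x) k y → Q y := by
  constructor
  · rintro ⟨U, hU, h⟩
    obtain ⟨x, hx⟩ := exists_isTopCommittee (fun c => (V + U).countP (c ∈ ·)) k hk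
    -- Members of `x` now receive all `n` new approvals, at least as many as from `U`; the other
    -- candidates receive none.
    have h₁ : ∀ c ∈ x, (V + U).countP (c ∈ ·) ≤ boost (fun c => V.countP (c ∈ ·)) n x c := by
      intro c hc
      rw [Multiset.countP_add, boost, if_pos hc, ← hU]
      exact Nat.add_le_add_left (Multiset.countP_le_card _ _) _
    have h₂ : ∀ c ∉ x, boost (fun c => V.countP (c ∈ ·)) n x c ≤ (V + U).countP (c ∈ ·) := by
      intro c hc
      rw [Multiset.countP_add, boost, if_neg hc]
      omega
    exact ⟨x, hx.of_le_on h₁ h₂, fun y hy =>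
      h y ((mem_AV_iff_isTopCommittee _ _ _).2 (hx.of_isTopCommittee_of_le_on h₁ h₂ hy))⟩
  · rintro ⟨x, -, h⟩
    refine ⟨Multiset.replicate n x, Multiset.card_replicate _ _, fun y hy => h y ?_⟩
    rwa [mem_AV_iff_isTopCommittee, countP_add_replicate] at hy

/-- The promoted committee may be chosen upward closed among candidates that are interchangeable
for the manipulators. -/
theorem exists_isTopCommittee_upward_closed [Fintype C] {s : C → ℕ} {n k : ℕ} {Q : Finset C → Prop}
    (rank : C → ℕ) (hrank : ∀ c d, rank c < rank d → s c ≤ s d) (same : C → C → Prop)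
    (hQ : ∀ c d, same c d → ∀ y : Finset C, Q (y.map (Equiv.swap c d).toEmbedding) → Q y)
    (h : ∃ x, IsTopCommittee (boost s n x) k x ∧ ∀ y, IsTopCommittee (boost s n x) k y → Q y) :
    ∃ x, (∀ y, IsTopCommittee (boost s n x) k y → Q y) ∧
      ∀ c ∈ x, ∀ d, same c d → rank c < rank d → d ∈ x := by
  classical
  obtain ⟨x₀, hx₀⟩ := h
  -- Extremal choice: among all successful `x`, one with the largest sum of ranks. A violation of
  -- upward closure would allow a swap that increases this sum.
  obtain ⟨x, hx, hmax⟩ := exists_max_image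
    (univ.filter fun x => IsTopCommittee (boost s n x) k x ∧
      ∀ y, IsTopCommittee (boost s n x) k y → Q y)
    (fun x => ∑ c ∈ x, rank c) ⟨x₀, by simpa using hx₀⟩
  simp only [mem_filter, mem_univ, true_and] at hx hmax
  refine ⟨x, hx.2, fun c hc d hcd hlt => ?_⟩
  by_contra hd
  have hne : c ≠ d := fun e => hd (e ▸ hc)
  set π := Equiv.swap c d with hπ
  have hboost : ∀ e, boost s n (x.map π.toEmbedding) (π e) =
      s (π e) + if e ∈ x then n else 0 := by
    intro e
    simp [boost]
  -- Read along `π`, members of `x` do not lose and the others do not gain, since `π` trades `c` for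
  -- the candidate `d` with at least the same score.
  have hs : ∀ e, (e ∈ x → s e ≤ s (π e)) ∧ (e ∉ x → s (π e) ≤ s e) := by
    intro e
    rcases eq_or_ne e c with rfl | hec
    · simpa [hπ, hc] using hrank _ _ hlt
    rcases eq_or_ne e d with rfl | hed
    · simpa [hπ, hd] using hrank _ _ hlt
    simp [hπ, Equiv.swap_apply_of_ne_of_ne hec hed]
  have h₁ : ∀ e ∈ x, boost s n x e ≤ boost s n (x.map π.toEmbedding) (π e) := by
    intro e he
    rw [hboost, boost]
    exact Nat.add_le_add_right ((hs e).1 he) _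
  have h₂ : ∀ e ∉ x, boost s n (x.map π.toEmbedding) (π e) ≤ boost s n x e := by
    intro e he
    rw [hboost, boost]
    exact Nat.add_le_add_right ((hs e).2 he) _
  -- A top committee `y` after the swap is carried by `π` to a top committee for the original `x`,
  -- so `Q` holds for `y.map π`, and `hQ` returns to `y`.
  have := hmax (x.map π.toEmbedding)
    ⟨(isTopCommittee_map_iff _ _ _ _).2 (hx.1.of_le_on h₁ h₂), fun y hy => hQ c d hcd y (hx.2 _
      (hx.1.of_isTopCommittee_of_le_on h₁ h₂ ((isTopCommittee_map_iff _ _ _ _).1 ?_)))⟩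
  · rw [sum_map, ← add_sum_erase _ _ hc, ← add_sum_erase _ rank hc] at this
    have e : ∑ a ∈ x.erase c, rank (π.toEmbedding a) = ∑ a ∈ x.erase c, rank a := by
      refine sum_congr rfl fun a ha => ?_
      have hac := ne_of_mem_erase ha
      have had : a ≠ d := fun e => hd (e ▸ mem_of_mem_erase ha)
      simp [hπ, Equiv.swap_apply_of_ne_of_ne hac had]
    rw [e] at this
    simp [hπ] at this
    omega
  · convert hy
    ext a
    simp [hπ]

/-- The forced members of a winning committee contain, or the possible members miss, sufficiently
many candidates such that all winning committees have more members in `v` than `w` has. -/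
def CardCondition (F G w v : Finset C) : Prop :=
  (v ∩ w).card < (F ∩ v).card ∨ (G \ v).card < (w \ v).card

/-- All winning committees contain `v ∩ w`. -/
def SubsetCondition (F G w v : Finset C) : Prop :=
  (v ∩ w).card ≤ (F ∩ (v ∩ w)).card ∨ (G \ (v ∩ w)).card ≤ (w \ (v ∩ w)).card

/-- This is `forall_le_card_inter_iff` for `A = v` and `n = |v ∩ w| + 1`. Since `|w| = |v ∩ w| + |w
\ v|`, its second alternative turns into a comparison of two cardinalities, which a counting formula
can express. -/
theorem forall_card_lt_iff {F G w : Finset C} (hFG : F ⊆ G) (hF : F.card ≤ w.card)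
    (hG : w.card ≤ G.card) (v : Finset C) :
    (∀ y : Finset C, y.card = w.card → F ⊆ y → y ⊆ G → (v ∩ w).card < (v ∩ y).card) ↔
      CardCondition F G w v := by
  have e := card_inter_add_card_sdiff w v
  rw [inter_comm] at e
  exact (forall_le_card_inter_iff hFG hF hG v _).trans
    (or_congr Iff.rfl ⟨fun h => by omega, fun h => by omega⟩)

/-- Containing `v ∩ w` means having `|v ∩ w|` elements in it, so `forall_le_card_inter_iff` applies
again, now with `A = v ∩ w`. -/
theorem forall_subset_iff {F G w : Finset C} (hFG : F ⊆ G) (hF : F.card ≤ w.card)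
    (hG : w.card ≤ G.card) (v : Finset C) :
    (∀ y : Finset C, y.card = w.card → F ⊆ y → y ⊆ G → v ∩ w ⊆ y) ↔
      SubsetCondition F G w v := by
  have e := card_inter_add_card_sdiff w (v ∩ w)
  rw [inter_eq_right.2 inter_subset_right] at e
  have h := (forall_le_card_inter_iff hFG hF hG (v ∩ w) (v ∩ w).card).trans
    (or_congr Iff.rfl ⟨fun h => (by omega : (G \ (v ∩ w)).card ≤ (w \ (v ∩ w)).card),
      fun h => by omega⟩)
  rw [SubsetCondition, ← h]
  refine forall_congr' fun y => imp_congr_right fun _ => imp_congr_right fun _ =>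
    imp_congr_right fun _ => ?_
  rw [← inter_eq_left]
  exact ⟨fun h => by rw [h], fun h => eq_of_subset_of_card_le inter_subset_left h⟩

/-- Coalition manipulation with an arbitrary goal `Q`, in terms of one cut for each type of
candidates and a threshold. -/
theorem exists_votes_iff_exists_cuts [Fintype C] (V : Multiset (Finset C)) (n k : ℕ)
    (hk : k ≤ Fintype.card C) {B : ℕ} (hB : V.card + n ≤ B) (Q : Finset C → Prop)
    {τ : Type} (type : C → τ) (rank : C → ℕ)
    (hinj : Function.Injective rank)
    (hrank : ∀ c d, rank c < rank d → V.countP (c ∈ ·) ≤ V.countP (d ∈ ·))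
    (hQ : ∀ c d, type c = type d → ∀ y : Finset C,
      Q (y.map (Equiv.swap c d).toEmbedding) → Q y) :
    (∃ U : Multiset (Finset C), U.card = n ∧ ∀ y ∈ AV (V + U) k, Q y) ↔
      ∃ θ ≤ B, ∃ z : τ → Option C, ∃ x F G : Finset C,
        (∀ c, c ∈ x ↔ ∃ j, ∃ a ∈ z j, type c = type a ∧ rank a ≤ rank c) ∧
        (∀ c, c ∈ F ↔ θ < boost (fun c => V.countP (c ∈ ·)) n x c) ∧
        (∀ c, c ∈ G ↔ θ ≤ boost (fun c => V.countP (c ∈ ·)) n x c) ∧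
        F.card ≤ k ∧ k ≤ G.card ∧ ∀ y : Finset C, y.card = k → F ⊆ y → y ⊆ G → Q y := by
  classical
  constructor
  · intro h
    obtain ⟨x, hxQ, hx⟩ :=
      exists_isTopCommittee_upward_closed rank hrank (fun c d => type c = type d) hQ
      ((exists_votes_iff V n k hk Q).1 h)
    obtain ⟨z, hz⟩ := exists_cuts type rank hinj x hx
    obtain ⟨θ, hθ, h₁, h₂⟩ := exists_threshold (boost (fun c => V.countP (c ∈ ·)) n x) k
      B hk fun c => by
        rw [boost]
        exact (Nat.add_le_add (Multiset.countP_le_card _ _) (by split_ifs <;> omega)).trans hB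
    exact ⟨θ, hθ, z, x, _, _, hz, fun c => by simp, fun c => by simp, h₁, h₂,
      fun y hy hF hG => hxQ y ((isTopCommittee_iff_of_threshold h₁ h₂ y).2 ⟨hy, hF, hG⟩)⟩
  · rintro ⟨θ, -, z, x, F, G, -, hF, hG, h₁, h₂, h⟩
    -- Here `x` may be any set: every winner after its promotion lies between `F` and `G`, where the
    -- goal has been checked.
    refine ⟨Multiset.replicate n x, Multiset.card_replicate _ _, fun y hy => ?_⟩
    rw [mem_AV_iff_isTopCommittee, countP_add_replicate] at hy
    have hF' : F = univ.filter fun c => θ < boost (fun c => V.countP (c ∈ ·)) n x c := by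
      ext c
      simp [hF]
    have hG' : G = univ.filter fun c => θ ≤ boost (fun c => V.countP (c ∈ ·)) n x c := by
      ext c
      simp [hG]
    subst hF' hG'
    obtain ⟨hy₁, hy₂, hy₃⟩ := (isTopCommittee_iff_of_threshold h₁ h₂ y).1 hy
    exact h y hy₁ hy₂ hy₃

theorem map_swap_eq_self {v : Finset C} {c d : C} (h : c ∈ v ↔ d ∈ v) :
    v.map (Equiv.swap c d).toEmbedding = v := by
  ext a
  simp only [mem_map_equiv, Equiv.symm_swap]
  rcases eq_or_ne a c with rfl | hc
  · simp [h]
  rcases eq_or_ne a d with rfl | hd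
  · simp [h]
  rw [Equiv.swap_apply_of_ne_of_ne hc hd]

theorem inter_map_swap {v y : Finset C} {c d : C} (h : c ∈ v ↔ d ∈ v) :
    v ∩ y.map (Equiv.swap c d).toEmbedding = (v ∩ y).map (Equiv.swap c d).toEmbedding := by
  rw [map_inter, map_swap_eq_self h]

end Manipulation

/-! ### Derived connectives -/

namespace CountingFormula

variable {A : Type}

/-- Disjunction. -/
def or (φ ψ : CountingFormula A) : CountingFormula A := not (and (not φ) (not ψ))

/-- Equivalence. -/
def iff (φ ψ : CountingFormula A) : CountingFormula A := or (and φ ψ) (and (not φ) (not ψ))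

/-- Strict comparison of positions. -/
def lt (x y : ℕ) : CountingFormula A := not (le y x)

/-- The false formula. -/
def falsum : CountingFormula A := not (le 0 0)

/-- Strict comparison of numbers of positions. -/
def cmpLt (x : ℕ) (φ ψ : CountingFormula A) : CountingFormula A := not (cmp x ψ φ)

/-- Existential quantification over positions. -/
def ex (x : ℕ) (φ : CountingFormula A) : CountingFormula A := cmpLt x falsum φ

/-- Universal quantification over positions. -/
def all (x : ℕ) (φ : CountingFormula A) : CountingFormula A := not (ex x (not φ))

/-- Existential quantification over the variables `0, …, n - 1`. -/
def exMany : ℕ → CountingFormula A → CountingFormula A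
  | 0, φ => φ
  | n + 1, φ => exMany n (ex n φ)

/-- The number of positions below `N` with property `P`. -/
noncomputable def posCount (N : ℕ) (P : ℕ → Prop) : ℕ := {p | p < N ∧ P p}.ncard

theorem finite_positions (N : ℕ) (P : ℕ → Prop) : {p | p < N ∧ P p}.Finite :=
  (Set.finite_lt_nat N).subset fun _ h => h.1

theorem posCount_eq_of_iff {N a b : ℕ} {P : ℕ → Prop} (h : ∀ p, p < N ∧ P p ↔ a ≤ p ∧ p < b) :
    posCount N P = b - a := by
  have : {p | p < N ∧ P p} = (Finset.Ico a b : Set ℕ) := by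
    ext p
    simpa using h p
  rw [posCount, this, Set.ncard_coe_finset, Nat.card_Ico]

theorem posCount_pos_iff {N : ℕ} {P : ℕ → Prop} : 0 < posCount N P ↔ ∃ p < N, P p := by
  rw [posCount, Set.ncard_pos (finite_positions N P)]
  rfl

theorem posCount_congr {N : ℕ} {P Q : ℕ → Prop} (h : ∀ p < N, P p ↔ Q p) :
    posCount N P = posCount N Q := by
  unfold posCount
  congr 1
  ext p
  exact and_congr_right (h p)

theorem posCount_or {N : ℕ} {P Q : ℕ → Prop} (h : ∀ p, P p → ¬ Q p) :
    posCount N (fun p => P p ∨ Q p) = posCount N P + posCount N Q := by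
  unfold posCount
  rw [← Set.ncard_union_eq _ (finite_positions N P) (finite_positions N Q)]
  · congr 1
    ext p
    exact and_or_left
  · rw [Set.disjoint_left]
    exact fun p hp hq => h p hp.2 hq.2

theorem posCount_eq_card {N m : ℕ} {P : ℕ → Prop} (f : Fin m → ℕ) (hf : Function.Injective f)
    (s : Finset (Fin m)) (h : ∀ p, p < N ∧ P p ↔ ∃ c ∈ s, f c = p) : posCount N P = s.card := by
  have : {p | p < N ∧ P p} = f '' s := by
    ext p
    exact h p
  rw [posCount, this, Set.ncard_image_of_injective _ hf, Set.ncard_coe_finset]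

theorem posCount_eq_countP {N : ℕ} {α : Type} (l : List α) (d : α) (a : ℕ) (P : α → Bool)
    (hN : a + l.length ≤ N) :
    posCount N (fun p => (a ≤ p ∧ p < a + l.length) ∧ P (l.getD (p - a) d) = true) =
      l.countP P := by
  induction l using List.reverseRecOn with
  | nil =>
    rw [posCount_eq_of_iff (a := 0) (b := 0) (fun p => by simp)]
    simp
  | append_singleton l x ih =>
    rw [List.length_append, List.length_singleton] at hN
    rw [List.countP_append, ← ih (by omega), List.countP_singleton]
    have h : ∀ p < N, ((a ≤ p ∧ p < a + (l ++ [x]).length) ∧ P ((l ++ [x]).getD (p - a) d) = true) ↔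
        ((a ≤ p ∧ p < a + l.length) ∧ P (l.getD (p - a) d) = true) ∨
          (p = a + l.length ∧ P x = true) := by
      intro p _
      rw [List.length_append, List.length_singleton]
      rcases lt_trichotomy p (a + l.length) with h | h | h
      · by_cases hp : a ≤ p
        · rw [List.getD_append _ _ _ _ (by omega)]
          simp [hp, h, h.ne]
          omega
        · simp [hp]
          omega
      · subst h
        simp
      · simp [h.ne', h.not_gt]
        omega
    rw [posCount_congr h, posCount_or (by rintro p ⟨⟨_, h⟩, _⟩ ⟨h', _⟩; omega)]
    congr 1
    split_ifs with hx
    · rw [posCount_eq_of_iff (a := a + l.length) (b := a + l.length + 1)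
        (fun p => by simp [hx]; omega)]
      omega
    · rw [posCount_eq_of_iff (a := 0) (b := 0) (fun p => by simp [hx])]

/-! ### Truth of the derived connectives -/

variable [DecidableEq A]

/-- The formula `φ` is true over the string `T`. -/
def Holds (T : List A) (φ : CountingFormula A) (e : ℕ → ℕ) : Prop := φ.eval T e = true

variable {T : List A} {e : ℕ → ℕ} {φ ψ : CountingFormula A} {x y : ℕ}

theorem holds_sym {a : A} : Holds T (sym x a) e ↔ T[e x]? = some a := by
  simp [Holds, eval]

theorem holds_le : Holds T (le x y) e ↔ e x ≤ e y := by
  simp [Holds, eval]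

theorem holds_not : Holds T (not φ) e ↔ ¬ Holds T φ e := by
  simp [Holds, eval]

theorem holds_and : Holds T (and φ ψ) e ↔ Holds T φ e ∧ Holds T ψ e := by
  simp [Holds, eval]

theorem holds_cmp : Holds T (cmp x φ ψ) e ↔
    posCount T.length (fun p => Holds T φ (Function.update e x p)) ≤
      posCount T.length (fun p => Holds T ψ (Function.update e x p)) := by
  have h : ∀ P : ℕ → Prop, ∀ _ : DecidablePred P, Nat.count P T.length = posCount T.length P := by
    intro P _
    rw [Nat.count_eq_card_filter_range, posCount, ← Set.ncard_coe_finset]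
    congr 1
    ext p
    simp
  simp only [Holds, eval, decide_eq_true_eq, h]

theorem holds_or : Holds T (or φ ψ) e ↔ Holds T φ e ∨ Holds T ψ e := by
  simp only [or, holds_not, holds_and]
  tauto

theorem holds_iff : Holds T (iff φ ψ) e ↔ (Holds T φ e ↔ Holds T ψ e) := by
  simp only [iff, holds_not, holds_and, holds_or]
  tauto

theorem holds_lt : Holds T (lt x y) e ↔ e x < e y := by
  rw [lt, holds_not, holds_le, not_le]

theorem holds_falsum : ¬ Holds T falsum e := by
  simp [falsum, holds_not, holds_le]

theorem holds_cmpLt : Holds T (cmpLt x φ ψ) e ↔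
    posCount T.length (fun p => Holds T φ (Function.update e x p)) <
      posCount T.length (fun p => Holds T ψ (Function.update e x p)) := by
  rw [cmpLt, holds_not, holds_cmp, not_le]

theorem holds_ex : Holds T (ex x φ) e ↔ ∃ p < T.length, Holds T φ (Function.update e x p) := by
  rw [ex, holds_cmpLt, ← posCount_pos_iff, posCount_eq_of_iff (a := 0) (b := 0)
    (fun p => by simp [holds_falsum])]

theorem holds_all : Holds T (all x φ) e ↔ ∀ p < T.length, Holds T φ (Function.update e x p) := by
  simp only [all, holds_not, holds_ex]
  push Not
  rfl

theorem holds_exMany (n : ℕ) : Holds T (exMany n φ) e ↔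
    ∃ f : ℕ → ℕ, (∀ i < n, f i < T.length) ∧ Holds T φ (fun i => if i < n then f i else e i) := by
  induction n generalizing φ with
  | zero => simp [exMany]
  | succ n ih =>
    simp only [exMany, ih, holds_ex]
    constructor
    · rintro ⟨f, hf, p, hp, h⟩
      refine ⟨Function.update f n p, fun i hi => ?_, ?_⟩
      · rcases eq_or_ne i n with rfl | hne
        · simpa using hp
        · simpa [hne] using hf i (by omega)
      · convert h using 1
        funext i
        rcases eq_or_ne i n with rfl | hne
        · simp
        · simp only [Function.update_of_ne hne]
          simp only [show i < n + 1 ↔ i < n by omega]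
    · rintro ⟨f, hf, h⟩
      refine ⟨f, fun i hi => hf i (by omega), f n, hf n (by omega), ?_⟩
      convert h using 1
      funext i
      rcases eq_or_ne i n with rfl | hne
      · simp
      · simp only [Function.update_of_ne hne]
        simp only [show i < n + 1 ↔ i < n by omega]

end CountingFormula

/-! ### Positions in the encoding of an instance -/

noncomputable instance InputSymbol.decidableEq : DecidableEq InputSymbol := Classical.decEq _

noncomputable instance InputSymbol.fintype : Fintype InputSymbol where
  elems := {.manipulator, .voter, .candidate, .bit false, .bit true}
  complete := by
    rintro (_ | _ | _ | _ | _) <;> simp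

theorem List.getElem?_flatMap_of_length {α β : Type} (n : ℕ) (l : List α) (f : α → List β)
    (hf : ∀ a, (f a).length = n) (i r : ℕ) (hi : i < l.length) (hr : r < n) :
    (l.flatMap f)[i * n + r]? = (f l[i])[r]? := by
  induction l generalizing i with
  | nil => simp at hi
  | cons a l ih =>
    rw [List.flatMap_cons]
    cases i with
    | zero => rw [List.getElem?_append_left (by rw [hf]; omega)]; simp
    | succ i =>
      have e : (i + 1) * n + r - n = i * n + r := by rw [Nat.succ_mul]; omega
      rw [List.getElem?_append_right (by rw [hf, Nat.succ_mul]; omega), hf, e,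
        ih i (by simpa using hi)]
      simp

namespace ManipulationInstance

variable (I : ManipulationInstance)

/-- The number of votes. -/
def numVotes : ℕ := I.VM.length + I.V.length

/-- The input string followed by an end marker. -/
def tape : List (Option InputSymbol) := I.encode.map some ++ [none]

/-- The position of the line of a candidate. -/
def pos (c : Fin I.m) : ℕ := I.numVotes + c * (2 + I.numVotes)

/-- The vote with a given number, the manipulative votes coming first. -/
def vote (i : ℕ) : Finset (Fin I.m) := (I.VM ++ I.V).getD i ∅

theorem length_tape : I.tape.length = I.numVotes + I.m * (2 + I.numVotes) + 1 := by
  simp [tape, length_encode, numVotes]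

theorem pos_lt_pos {c d : Fin I.m} (h : c < d) : I.pos c + (2 + I.numVotes) ≤ I.pos d := by
  have : (c + 1 : ℕ) * (2 + I.numVotes) ≤ d * (2 + I.numVotes) := Nat.mul_le_mul_right _ h
  rw [Nat.succ_mul] at this
  unfold pos
  omega

theorem pos_injective : Function.Injective I.pos := by
  intro c d h
  rcases lt_trichotomy c d with h' | h' | h'
  · have := I.pos_lt_pos h'
    omega
  · exact h'
  · have := I.pos_lt_pos h'
    omega

theorem pos_le_pos_iff {c d : Fin I.m} : I.pos c ≤ I.pos d ↔ c ≤ d := by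
  rcases lt_trichotomy c d with h' | h' | h'
  · have := I.pos_lt_pos h'
    exact iff_of_true (by omega) h'.le
  · simp [h']
  · have := I.pos_lt_pos h'
    exact iff_of_false (by omega) (not_le.2 h')

theorem pos_add_lt (c : Fin I.m) : I.pos c + (2 + I.numVotes) < I.tape.length := by
  have : (c + 1 : ℕ) * (2 + I.numVotes) ≤ I.m * (2 + I.numVotes) := Nat.mul_le_mul_right _ c.2
  rw [Nat.succ_mul] at this
  rw [length_tape, pos]
  omega

theorem pos_lt (c : Fin I.m) : I.pos c < I.tape.length := by
  have := I.pos_add_lt c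
  omega

theorem numVotes_lt : I.numVotes < I.tape.length := by
  rw [length_tape]
  omega

theorem tape_of_lt_manipulators {p : ℕ} (hp : p < I.VM.length) :
    I.tape[p]? = some (some .manipulator) := by
  simp [tape, encode, hp, Nat.lt_add_right]

theorem tape_of_lt_numVotes {p : ℕ} (h₁ : I.VM.length ≤ p) (h₂ : p < I.numVotes) :
    I.tape[p]? = some (some .voter) := by
  unfold numVotes at h₂
  simp [tape, encode, List.getElem?_append, h₁.not_gt,
    show p - I.VM.length < I.V.length by omega]

theorem tape_pos_add (c : Fin I.m) {r : ℕ} (hr : r < 2 + I.numVotes) :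
    I.tape[I.pos c + r]? = (I.line c)[r]?.map some := by
  have hlt := I.pos_add_lt c
  have hlen : I.encode.length + 1 = I.tape.length := by simp [tape]
  have e : I.pos c + r - I.numVotes = c * (2 + I.numVotes) + r := by
    unfold pos
    omega
  rw [tape, List.getElem?_append_left (by simp; omega), List.getElem?_map, encode,
    List.getElem?_append_right (by simp [pos, numVotes]; omega)]
  simp only [List.length_append, List.length_map]
  change Option.map some (List.flatMap I.line _)[I.pos c + r - I.numVotes]? = _
  rw [e, List.getElem?_flatMap_of_length (2 + I.numVotes) _ _ (fun c => I.length_line c) c r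
    (by simp) hr]
  simp

theorem tape_pos (c : Fin I.m) : I.tape[I.pos c]? = some (some .candidate) := by
  simpa [line] using I.tape_pos_add c (r := 0) (by omega)

theorem tape_pos_add_one (c : Fin I.m) :
    I.tape[I.pos c + 1]? = some (some (.bit (decide (c ∈ I.w)))) := by
  simpa [line] using I.tape_pos_add c (r := 1) (by omega)

theorem tape_pos_add_two_add (c : Fin I.m) {i : ℕ} (hi : i < I.numVotes) :
    I.tape[I.pos c + 2 + i]? = some (some (.bit (decide (c ∈ I.vote i)))) := by
  rw [add_assoc, I.tape_pos_add c (by omega), line, add_comm 2 i, List.getElem?_cons_succ,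
    List.getElem?_cons_succ, List.getElem?_map]
  have : i < (I.VM ++ I.V).length := by simpa [numVotes] using hi
  rw [vote, List.getD_eq_getElem _ _ this, List.getElem?_eq_getElem this]
  rfl

/-- Divide `p - numVotes` by the length of a line: remainder 0 is the marker of a candidate,
remainder 1 the committee bit, and any other remainder a vote bit. So behind the header there are no
header symbols, and markers stand only at starts of lines. -/
theorem tape_of_numVotes_le {p : ℕ} (hp : I.numVotes ≤ p) :
    (∃ c, p = I.pos c) ∨ I.tape[p]? = some none ∨ I.tape[p]? = none ∨
      ∃ b, I.tape[p]? = some (some (.bit b)) := by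
  set n := 2 + I.numVotes with hn
  have hdiv := Nat.div_add_mod (p - I.numVotes) n
  have hmod := Nat.mod_lt (p - I.numVotes) (show 0 < n by omega)
  rw [mul_comm] at hdiv
  rcases lt_or_ge ((p - I.numVotes) / n) I.m with h | h
  · let c : Fin I.m := ⟨_, h⟩
    have hp : p = I.pos c + (p - I.numVotes) % n := by
      simp only [pos, c, ← hn]
      omega
    rcases Nat.eq_zero_or_pos ((p - I.numVotes) % n) with h0 | h0
    · exact .inl ⟨c, by omega⟩
    · rcases Nat.eq_or_lt_of_le h0 with h1 | h1
      · exact .inr (.inr (.inr ⟨_, by rw [hp, ← h1]; exact I.tape_pos_add_one c⟩))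
      · obtain ⟨i, hi⟩ : ∃ i, (p - I.numVotes) % n = 2 + i := ⟨_ - 2, (Nat.add_sub_cancel' h1).symm⟩
        exact .inr (.inr (.inr ⟨_, by
          rw [hp, hi, ← add_assoc]
          exact I.tape_pos_add_two_add c (by omega)⟩))
  · have hle : I.m * n ≤ (p - I.numVotes) / n * n := Nat.mul_le_mul_right _ h
    have hlen := I.length_tape
    rw [← hn] at hlen
    rcases Nat.eq_or_lt_of_le (show I.encode.length ≤ p by
      simp only [tape, List.length_append, List.length_map, List.length_singleton] at hlen
      omega) with h | h
    · refine .inr (.inl ?_)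
      rw [tape, ← h, List.getElem?_append_right (by simp)]
      simp
    · exact .inr (.inr (.inl (by simp [tape]; omega)))

theorem tape_eq_manipulator_iff (p : ℕ) :
    I.tape[p]? = some (some .manipulator) ↔ p < I.VM.length := by
  refine ⟨fun h => ?_, I.tape_of_lt_manipulators⟩
  by_contra! h₁
  rcases lt_or_ge p I.numVotes with h₂ | h₂
  · rw [I.tape_of_lt_numVotes h₁ h₂] at h
    simp at h
  · rcases I.tape_of_numVotes_le h₂ with ⟨c, rfl⟩ | h' | h' | ⟨b, h'⟩
    · rw [tape_pos] at h
      simp at h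
    all_goals
      rw [h'] at h
      simp at h

theorem tape_eq_voter_iff (p : ℕ) :
    I.tape[p]? = some (some .voter) ↔ I.VM.length ≤ p ∧ p < I.numVotes := by
  refine ⟨fun h => ?_, fun h => I.tape_of_lt_numVotes h.1 h.2⟩
  by_contra! h'
  rcases lt_or_ge p I.VM.length with h₁ | h₁
  · rw [I.tape_of_lt_manipulators h₁] at h
    simp at h
  · rcases I.tape_of_numVotes_le (h' h₁) with ⟨c, rfl⟩ | h' | h' | ⟨b, h'⟩
    · rw [tape_pos] at h
      simp at h
    all_goals
      rw [h'] at h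
      simp at h

theorem tape_eq_candidate_iff (p : ℕ) :
    I.tape[p]? = some (some .candidate) ↔ ∃ c, p = I.pos c := by
  refine ⟨fun h => ?_, by rintro ⟨c, rfl⟩; exact I.tape_pos c⟩
  rcases lt_or_ge p I.VM.length with h₁ | h₁
  · rw [I.tape_of_lt_manipulators h₁] at h
    simp at h
  rcases lt_or_ge p I.numVotes with h₂ | h₂
  · rw [I.tape_of_lt_numVotes h₁ h₂] at h
    simp at h
  rcases I.tape_of_numVotes_le h₂ with h' | h' | h' | ⟨b, h'⟩
  · exact h'
  all_goals
    rw [h'] at h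
    simp at h

theorem forall_manipulator_iff (P : Finset (Fin I.m) → Prop) :
    (∀ v ∈ I.VM, P v) ↔ ∀ i < I.VM.length, P (I.vote i) := by
  have e : ∀ i, ∀ h : i < I.VM.length, I.vote i = I.VM[i] := by
    intro i h
    rw [vote, List.getD_append _ _ _ _ h, List.getD_eq_getElem _ _ h]
  constructor
  · intro h i hi
    rw [e i hi]
    exact h _ (List.getElem_mem hi)
  · intro h v hv
    obtain ⟨i, hi, rfl⟩ := List.getElem_of_mem hv
    rw [← e i hi]
    exact h i hi

/-- The number of nonmanipulative votes that approve a candidate. -/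
def score (c : Fin I.m) : ℕ := (I.V : Multiset (Finset (Fin I.m))).countP (c ∈ ·)

/-- A position in the header doubles as the number of a vote, so a score is a number of positions.
-/
theorem posCount_voters {N : ℕ} (hN : I.numVotes ≤ N) (c : Fin I.m) :
    CountingFormula.posCount N (fun p => (I.VM.length ≤ p ∧ p < I.numVotes) ∧ c ∈ I.vote p) =
      I.score c := by
  have h := CountingFormula.posCount_eq_countP I.V ∅ I.VM.length (fun v => decide (c ∈ v)) hN
  rw [score, Multiset.coe_countP, ← h]
  refine CountingFormula.posCount_congr fun p _ => and_congr_right fun h => ?_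
  rw [vote, List.getD_append_right _ _ _ _ h.1, decide_eq_true_eq]

end ManipulationInstance

/-! ### Formulas for coalition manipulation -/

namespace ManipulationInstance

open CountingFormula

/-- Formulas over the encoding of an instance. -/
abbrev Formula : Type := CountingFormula (Option InputSymbol)

/-- The symbol `s` stands at position `x`. -/
def symF (x : ℕ) (s : InputSymbol) : Formula := sym x (some s)

/-- The vote at position `i` of the header approves the candidate with line `p`. -/
def approvesF (p i : ℕ) : Formula :=
  -- These are names of variables, chosen larger than the names in use and hence fresh; the later
  -- formulas do the same.
  let q := p + i + 1
  let r := p + i + 2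
  let between : Formula := and (lt p r) (lt r q)
  -- Positions cannot be added inside a formula, so the bit is located by counting: as many
  -- positions lie strictly between `p` and `q` as there are up to `i`. This puts `q` exactly `i +
  -- 2` places after `p`, behind the marker and the committee bit.
  ex q (and (and (cmp r between (le r i)) (cmp r (le r i) between)) (symF q (.bit true)))

/-- The candidate with line `p` belongs to the committee. -/
def memberF (p : ℕ) : Formula :=
  -- The variable named `p + 1` is forced to the position right after that of `p`, where the
  -- committee bit stands.
  ex (p + 1) (and (and (lt p (p + 1)) (not (ex (p + 2) (and (lt p (p + 2)) (lt (p + 2) (p + 1))))))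
    (symF (p + 1) (.bit true)))

/-- The candidates with lines `p` and `z` are interchangeable for the manipulators. -/
def sameF (p z : ℕ) : Formula :=
  let i := p + z + 1
  and (iff (memberF p) (memberF z))
    (all i (or (not (symF i .manipulator)) (iff (approvesF p i) (approvesF z i))))

/-- The candidate with line `p` ranks at least as high as the one with line `z`. -/
def ranksF (p z : ℕ) : Formula :=
  let i := p + z + 1
  or (cmpLt i (and (symF i .voter) (approvesF z i)) (and (symF i .voter) (approvesF p i)))
    (and (cmp i (and (symF i .voter) (approvesF z i)) (and (symF i .voter) (approvesF p i)))
      (le p z))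

/-- The candidate with line `p` is promoted by one of the cuts `0, …, n - 1`. -/
def promotedF (p : ℕ) : ℕ → Formula
  | 0 => falsum
  -- A cut variable that does not stand on a candidate marker promotes nobody; this covers types
  -- without members in `x`.
  | n + 1 => or (promotedF p n) (and (symF n .candidate) (and (sameF p n) (ranksF p n)))

/-- The vote at position `i` of the header approves the candidate with line `p` after the
manipulation with `n` cuts. -/
def newApprovalF (n p i : ℕ) : Formula :=
  or (and (symF i .voter) (approvesF p i)) (and (symF i .manipulator) (promotedF p n))

/-- The candidate with line `p` exceeds the threshold held by the variable `n`. -/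
def exceedsF (n p : ℕ) : Formula :=
  -- The threshold is stored as a position and becomes a number by counting the positions below it.
  cmpLt (p + n + 1) (lt (p + n + 1) n) (newApprovalF n p (p + n + 1))

/-- The candidate with line `p` reaches the threshold held by the variable `n`. -/
def reachesF (n p : ℕ) : Formula :=
  cmp (p + n + 1) (lt (p + n + 1) n) (newApprovalF n p (p + n + 1))

/-- The variable `n + 1` holds the line of a candidate with property `φ`. -/
def candidateF (n : ℕ) (φ : Formula) : Formula := and (symF (n + 1) .candidate) φ

/-- The formula for `CardCondition`; the manipulator is held by the variable `n + 2`. -/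
def cardConditionF (n : ℕ) : Formula :=
  let c := n + 1
  let v := approvesF c (n + 2)
  or (cmpLt c (candidateF n (and v (memberF c))) (candidateF n (and (exceedsF n c) v)))
    (cmpLt c (candidateF n (and (reachesF n c) (not v))) (candidateF n (and (memberF c) (not v))))

/-- The formula for `SubsetCondition`; the manipulator is held by the variable `n + 2`. -/
def subsetConditionF (n : ℕ) : Formula :=
  let c := n + 1
  let u := and (approvesF c (n + 2)) (memberF c)
  or (cmp c (candidateF n u) (candidateF n (and (exceedsF n c) u)))
    (cmp c (candidateF n (and (reachesF n c) (not u))) (candidateF n (and (memberF c) (not u))))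

/-- There are `n` cuts and a threshold such that the condition `φ` holds for all manipulators. -/
def manipulationF (n : ℕ) (φ : Formula) : Formula :=
  let c := n + 1
  exMany (n + 1) (and (and (cmp c (candidateF n (exceedsF n c)) (candidateF n (memberF c)))
      (cmp c (candidateF n (memberF c)) (candidateF n (reachesF n c))))
    (all (n + 2) (or (not (symF (n + 2) .manipulator)) φ)))

/-! ### Meaning of the formulas over an encoded instance -/

variable {I : ManipulationInstance} {e : ℕ → ℕ} {c d : Fin I.m} {p z i n x : ℕ}

theorem holds_approvesF (hp : e p = I.pos c) (hi : e i < I.numVotes) :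
    Holds I.tape (approvesF p i) e ↔ c ∈ I.vote (e i) := by
  have hlt := I.pos_add_lt c
  have hN := I.numVotes_lt
  have e₁ : p ≠ p + i + 1 := by omega
  have e₂ : i ≠ p + i + 1 := by omega
  have e₃ : p ≠ p + i + 2 := by omega
  have e₄ : i ≠ p + i + 2 := by omega
  have e₅ : p + i + 1 ≠ p + i + 2 := by omega
  simp only [approvesF, symF, holds_ex, holds_and, holds_cmp, holds_lt, holds_le, holds_sym,
    Function.update_self, Function.update_of_ne e₁, Function.update_of_ne e₂,
    Function.update_of_ne e₃, Function.update_of_ne e₄, Function.update_of_ne e₅, hp]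
  have h₁ : ∀ q < I.tape.length,
      posCount I.tape.length (fun r => I.pos c < r ∧ r < q) = q - (I.pos c + 1) :=
    fun q hq => posCount_eq_of_iff fun r => by omega
  have h₂ : posCount I.tape.length (fun r => r ≤ e i) = (e i + 1) - 0 :=
    posCount_eq_of_iff fun r => by omega
  constructor
  · rintro ⟨q, hq, ⟨h₃, h₄⟩, h₅⟩
    rw [h₁ q hq, h₂] at h₃ h₄
    obtain rfl : q = I.pos c + 2 + e i := by omega
    rw [I.tape_pos_add_two_add c hi] at h₅
    simpa using h₅
  · intro h
    have hq : I.pos c + 2 + e i < I.tape.length := by omega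
    refine ⟨_, hq, ?_, by rw [I.tape_pos_add_two_add c hi]; simpa using h⟩
    rw [h₁ _ hq, h₂]
    omega

theorem holds_memberF (hp : e p = I.pos c) : Holds I.tape (memberF p) e ↔ c ∈ I.w := by
  have hlt := I.pos_add_lt c
  have e₁ : p ≠ p + 1 := by omega
  have e₂ : p ≠ p + 2 := by omega
  have e₃ : p + 1 ≠ p + 2 := by omega
  simp only [memberF, symF, holds_ex, holds_and, holds_not, holds_lt, holds_sym,
    Function.update_self, Function.update_of_ne e₁, Function.update_of_ne e₂,
    Function.update_of_ne e₃, hp]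
  constructor
  · rintro ⟨q, hq, ⟨h₁, h₂⟩, h₃⟩
    obtain rfl : q = I.pos c + 1 := by
      by_contra h
      exact h₂ ⟨I.pos c + 1, by omega, by omega, by omega⟩
    rw [I.tape_pos_add_one] at h₃
    simpa using h₃
  · intro h
    refine ⟨I.pos c + 1, by omega, ⟨by omega, ?_⟩, by rw [I.tape_pos_add_one]; simpa using h⟩
    rintro ⟨r, -, h⟩
    omega

/-- The candidates `c` and `d` are interchangeable for the manipulators. -/
def Same (I : ManipulationInstance) (c d : Fin I.m) : Prop :=
  (c ∈ I.w ↔ d ∈ I.w) ∧ ∀ i < I.VM.length, (c ∈ I.vote i ↔ d ∈ I.vote i)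

theorem manipulators_le : I.VM.length ≤ I.numVotes := Nat.le_add_right _ _

theorem holds_sameF (hp : e p = I.pos c) (hz : e z = I.pos d) :
    Holds I.tape (sameF p z) e ↔ I.Same c d := by
  have e₁ : p ≠ p + z + 1 := by omega
  have e₂ : z ≠ p + z + 1 := by omega
  simp only [sameF, holds_and, holds_iff, holds_memberF hp, holds_memberF hz, holds_all, holds_or,
    holds_not, Same, symF, holds_sym, tape_eq_manipulator_iff, Function.update_self]
  refine and_congr_right fun _ => ⟨fun h i hi => ?_, fun h i _ => ?_⟩
  · have hi' := hi.trans_le I.manipulators_le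
    have := (h i (hi'.trans I.numVotes_lt)).resolve_left (not_not.2 hi)
    rwa [holds_approvesF (c := c) (by simpa [e₁] using hp) (by simpa using hi'),
      holds_approvesF (c := d) (by simpa [e₂] using hz) (by simpa using hi'),
      Function.update_self] at this
  · refine or_iff_not_imp_left.2 fun hi => ?_
    have hi := not_not.1 hi
    have hi' := hi.trans_le I.manipulators_le
    rw [holds_approvesF (c := c) (by simpa [e₁] using hp) (by simpa using hi'),
      holds_approvesF (c := d) (by simpa [e₂] using hz) (by simpa using hi'),
      Function.update_self]
    exact h i hi

theorem posCount_approvesF (hp : e p = I.pos c) (hi : p ≠ i) :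
    posCount I.tape.length (fun q =>
      Holds I.tape (and (symF i .voter) (approvesF p i)) (Function.update e i q)) = I.score c := by
  rw [← I.posCount_voters I.numVotes_lt.le]
  refine posCount_congr fun q _ => ?_
  rw [holds_and, symF, holds_sym, Function.update_self, tape_eq_voter_iff]
  refine and_congr_right fun h => ?_
  rw [holds_approvesF (c := c) (by simpa [hi] using hp) (by simpa using h.2), Function.update_self]

theorem holds_ranksF (hp : e p = I.pos c) (hz : e z = I.pos d) :
    Holds I.tape (ranksF p z) e ↔ I.score d < I.score c ∨ (I.score d ≤ I.score c ∧ c ≤ d) := by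
  rw [ranksF, holds_or, holds_and, holds_cmpLt, holds_cmp, holds_le, hp, hz,
    posCount_approvesF hp (by omega), posCount_approvesF hz (by omega), pos_le_pos_iff]

/-- The rank of a candidate: candidates with higher scores rank higher, and of those with equal
scores the ones with lower numbers. -/
def rank (I : ManipulationInstance) (c : Fin I.m) : ℕ := I.score c * I.m + (I.m - 1 - c)

theorem rank_lt_rank_of_score_lt (h : I.score c < I.score d) : I.rank c < I.rank d := by
  have := Nat.mul_le_mul_right I.m (Nat.succ_le_of_lt h)
  rw [Nat.succ_mul] at this
  have := c.2
  unfold rank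
  omega

theorem rank_le_rank_iff :
    I.rank d ≤ I.rank c ↔ I.score d < I.score c ∨ (I.score d ≤ I.score c ∧ c ≤ d) := by
  rcases lt_trichotomy (I.score d) (I.score c) with h | h | h
  · exact iff_of_true (rank_lt_rank_of_score_lt h).le (.inl h)
  · have := c.2
    have := d.2
    simp only [rank, h, lt_irrefl, le_refl, true_and, false_or, Fin.le_def]
    omega
  · exact iff_of_false (rank_lt_rank_of_score_lt h).not_ge (by omega)

theorem score_le_of_rank_lt (h : I.rank c < I.rank d) : I.score c ≤ I.score d := by
  by_contra! h'
  exact (rank_lt_rank_of_score_lt h').not_gt h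

theorem rank_injective : Function.Injective I.rank := by
  intro c d h
  have h₁ := rank_le_rank_iff.1 h.le
  have h₂ := rank_le_rank_iff.1 h.ge
  refine le_antisymm ?_ ?_ <;> omega

theorem holds_promotedF (hp : e p = I.pos c) : Holds I.tape (promotedF p n) e ↔
    ∃ j < n, ∃ a, e j = I.pos a ∧ I.Same c a ∧ I.rank a ≤ I.rank c := by
  induction n with
  | zero => simp [promotedF, holds_falsum]
  | succ n ih =>
    have h : Holds I.tape (and (symF n .candidate) (and (sameF p n) (ranksF p n))) e ↔
        ∃ a, e n = I.pos a ∧ I.Same c a ∧ I.rank a ≤ I.rank c := by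
      rw [holds_and, symF, holds_sym, tape_eq_candidate_iff, ← exists_and_right]
      refine exists_congr fun a => and_congr_right fun ha => ?_
      rw [holds_and, holds_sameF hp ha, holds_ranksF hp ha, rank_le_rank_iff]
    rw [promotedF, holds_or, ih, h]
    constructor
    · rintro (⟨j, hj, h⟩ | h)
      · exact ⟨j, by omega, h⟩
      · exact ⟨n, by omega, h⟩
    · rintro ⟨j, hj, h⟩
      rcases Nat.lt_succ_iff_lt_or_eq.1 hj with hj | hj
      · exact .inl ⟨j, hj, h⟩
      · exact .inr (hj ▸ h)

/-- The candidates in `X` are those that are promoted by the cuts held by the variables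
`0, …, n - 1`. -/
def IsPromoted (I : ManipulationInstance) (n : ℕ) (e : ℕ → ℕ) (X : Finset (Fin I.m)) : Prop :=
  ∀ c, c ∈ X ↔ ∃ j < n, ∃ a, e j = I.pos a ∧ I.Same c a ∧ I.rank a ≤ I.rank c

variable {X : Finset (Fin I.m)}

theorem IsPromoted.update (hX : I.IsPromoted n e X) {k q : ℕ} (hk : n ≤ k) :
    I.IsPromoted n (Function.update e k q) X := by
  intro c
  rw [hX c]
  refine exists_congr fun j => and_congr_right fun hj => ?_
  rw [Function.update_of_ne (by omega)]

/-- The voter positions contribute the old score, and each manipulator position contributes one more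
if `c` is promoted; no position carries both symbols. Since `n ≤ i`, binding `i` leaves the cuts
alone. -/
theorem posCount_newApprovalF (hX : I.IsPromoted n e X) (hp : e p = I.pos c) (hi : p ≠ i)
    (hni : n ≤ i) :
    posCount I.tape.length (fun q =>
      Holds I.tape (newApprovalF n p i) (Function.update e i q)) =
      boost I.score I.VM.length X c := by
  have hN := I.numVotes_lt
  have hM := I.manipulators_le
  simp only [newApprovalF, holds_or]
  rw [posCount_or, posCount_approvesF hp hi, boost]
  · congr 1
    have h : ∀ q, Holds I.tape (and (symF i .manipulator) (promotedF p n))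
        (Function.update e i q) ↔ q < I.VM.length ∧ c ∈ X := by
      intro q
      rw [holds_and, symF, holds_sym, Function.update_self, tape_eq_manipulator_iff,
        holds_promotedF (c := c) (by simpa [hi] using hp), hX.update hni]
    simp only [h]
    split_ifs with hc
    · rw [posCount_eq_of_iff (a := 0) (b := I.VM.length) (fun q => by simp [hc]; omega)]
      rfl
    · rw [posCount_eq_of_iff (a := 0) (b := 0) (fun q => by simp [hc])]
  · intro q h₁ h₂
    rw [holds_and, symF, holds_sym] at h₁ h₂
    rw [h₁.1] at h₂
    simp at h₂

theorem posCount_lt {a N : ℕ} (h : a < N) : posCount N (fun q => q < a) = a :=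
  (posCount_eq_of_iff (a := 0) fun q => by omega).trans (Nat.sub_zero a)

theorem holds_exceedsF (hX : I.IsPromoted n e X) (hθ : e n < I.tape.length)
    (hp : e p = I.pos c) :
    Holds I.tape (exceedsF n p) e ↔ e n < boost I.score I.VM.length X c := by
  rw [exceedsF, holds_cmpLt, posCount_newApprovalF hX hp (by omega) (by omega)]
  simp only [holds_lt, Function.update_self, Function.update_of_ne (show n ≠ p + n + 1 by omega),
    posCount_lt hθ]

theorem holds_reachesF (hX : I.IsPromoted n e X) (hθ : e n < I.tape.length)
    (hp : e p = I.pos c) :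
    Holds I.tape (reachesF n p) e ↔ e n ≤ boost I.score I.VM.length X c := by
  rw [reachesF, holds_cmp, posCount_newApprovalF hX hp (by omega) (by omega)]
  simp only [holds_lt, Function.update_self, Function.update_of_ne (show n ≠ p + n + 1 by omega),
    posCount_lt hθ]

/-- Each candidate is represented by the start of its line, so `cmp` can compare cardinalities of
sets of candidates. -/
theorem posCount_candidateF {φ : Formula} (s : Finset (Fin I.m))
    (h : ∀ c, Holds I.tape φ (Function.update e (n + 1) (I.pos c)) ↔ c ∈ s) :
    posCount I.tape.length (fun q =>
      Holds I.tape (candidateF n φ) (Function.update e (n + 1) q)) = s.card := by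
  refine posCount_eq_card I.pos I.pos_injective s fun q => ?_
  rw [candidateF, holds_and, symF, holds_sym, Function.update_self, tape_eq_candidate_iff]
  constructor
  · rintro ⟨-, ⟨c, rfl⟩, hc⟩
    exact ⟨c, (h c).1 hc, rfl⟩
  · rintro ⟨c, hc, rfl⟩
    exact ⟨I.pos_lt c, ⟨c, rfl⟩, (h c).2 hc⟩

variable {F G : Finset (Fin I.m)}

theorem holds_exceedsF_update (hX : I.IsPromoted n e X) (hθ : e n < I.tape.length)
    (hF : ∀ c, c ∈ F ↔ e n < boost I.score I.VM.length X c) (c : Fin I.m) :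
    Holds I.tape (exceedsF n (n + 1)) (Function.update e (n + 1) (I.pos c)) ↔ c ∈ F := by
  rw [holds_exceedsF (c := c) (hX.update (by omega)) (by simpa using hθ) (by simp), hF]
  simp

theorem holds_reachesF_update (hX : I.IsPromoted n e X) (hθ : e n < I.tape.length)
    (hG : ∀ c, c ∈ G ↔ e n ≤ boost I.score I.VM.length X c) (c : Fin I.m) :
    Holds I.tape (reachesF n (n + 1)) (Function.update e (n + 1) (I.pos c)) ↔ c ∈ G := by
  rw [holds_reachesF (c := c) (hX.update (by omega)) (by simpa using hθ) (by simp), hG]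
  simp

theorem holds_memberF_update (k : ℕ) (c : Fin I.m) :
    Holds I.tape (memberF k) (Function.update e k (I.pos c)) ↔ c ∈ I.w :=
  holds_memberF (by simp)

theorem holds_approvesF_update (hi : e (n + 2) < I.numVotes) (c : Fin I.m) :
    Holds I.tape (approvesF (n + 1) (n + 2)) (Function.update e (n + 1) (I.pos c)) ↔
      c ∈ I.vote (e (n + 2)) := by
  rw [holds_approvesF (c := c) (by simp) (by simpa using hi)]
  simp

theorem holds_cardConditionF (hX : I.IsPromoted n e X) (hθ : e n < I.tape.length)
    (hF : ∀ c, c ∈ F ↔ e n < boost I.score I.VM.length X c)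
    (hG : ∀ c, c ∈ G ↔ e n ≤ boost I.score I.VM.length X c) (hi : e (n + 2) < I.numVotes) :
    Holds I.tape (cardConditionF n) e ↔ CardCondition F G I.w (I.vote (e (n + 2))) := by
  have h₁ := holds_exceedsF_update hX hθ hF
  have h₂ := holds_reachesF_update hX hθ hG
  have h₃ := holds_approvesF_update hi
  have h₄ := fun c => holds_memberF_update (I := I) (e := e) (n + 1) c
  rw [cardConditionF, holds_or, holds_cmpLt, holds_cmpLt, CardCondition]
  rw [posCount_candidateF (I.vote (e (n + 2)) ∩ I.w) fun c => by
      rw [holds_and, h₃, h₄, Finset.mem_inter],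
    posCount_candidateF (F ∩ I.vote (e (n + 2))) fun c => by
      rw [holds_and, h₁, h₃, Finset.mem_inter],
    posCount_candidateF (G \ I.vote (e (n + 2))) fun c => by
      rw [holds_and, holds_not, h₂, h₃, Finset.mem_sdiff],
    posCount_candidateF (I.w \ I.vote (e (n + 2))) fun c => by
      rw [holds_and, holds_not, h₄, h₃, Finset.mem_sdiff]]

theorem holds_subsetConditionF (hX : I.IsPromoted n e X) (hθ : e n < I.tape.length)
    (hF : ∀ c, c ∈ F ↔ e n < boost I.score I.VM.length X c)
    (hG : ∀ c, c ∈ G ↔ e n ≤ boost I.score I.VM.length X c) (hi : e (n + 2) < I.numVotes) :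
    Holds I.tape (subsetConditionF n) e ↔ SubsetCondition F G I.w (I.vote (e (n + 2))) := by
  have h₁ := holds_exceedsF_update hX hθ hF
  have h₂ := holds_reachesF_update hX hθ hG
  have h₃ := holds_approvesF_update hi
  have h₄ := fun c => holds_memberF_update (I := I) (e := e) (n + 1) c
  rw [subsetConditionF, holds_or, holds_cmp, holds_cmp, SubsetCondition]
  rw [posCount_candidateF (I.vote (e (n + 2)) ∩ I.w) fun c => by
      rw [holds_and, h₃, h₄, Finset.mem_inter],
    posCount_candidateF (F ∩ (I.vote (e (n + 2)) ∩ I.w)) fun c => by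
      rw [holds_and, holds_and, h₁, h₃, h₄, Finset.mem_inter, Finset.mem_inter],
    posCount_candidateF (G \ (I.vote (e (n + 2)) ∩ I.w)) fun c => by
      rw [holds_and, holds_not, holds_and, h₂, h₃, h₄, Finset.mem_sdiff, Finset.mem_inter],
    posCount_candidateF (I.w \ (I.vote (e (n + 2)) ∩ I.w)) fun c => by
      rw [holds_and, holds_not, holds_and, h₃, h₄, Finset.mem_sdiff, Finset.mem_inter]]

/-- The membership of a candidate in the committee and in the votes of at most `t` manipulators. -/
def candidateType (I : ManipulationInstance) (t : ℕ) (c : Fin I.m) : Bool × (Fin t → Bool) :=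
  (decide (c ∈ I.w), fun i => decide (i < I.VM.length ∧ c ∈ I.vote i))

theorem candidateType_eq_iff {t : ℕ} (ht : I.VM.length ≤ t) :
    I.candidateType t c = I.candidateType t d ↔ I.Same c d := by
  simp only [candidateType, Prod.mk.injEq, decide_eq_decide, funext_iff, Same]
  refine and_congr_right fun _ => ⟨fun h i hi => ?_, fun h i => and_congr_right (h i)⟩
  simpa [hi] using h ⟨i, hi.trans_le ht⟩

/-- Quantification over cuts held by variables amounts to quantification over one optional
candidate for each type. -/
theorem exists_isPromoted_iff {τ : Type} [Fintype τ] (Φ : Finset (Fin I.m) → Prop) :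
    (∃ f : ℕ → ℕ, (∀ i < Fintype.card τ, f i < I.tape.length) ∧
        ∃ X, I.IsPromoted (Fintype.card τ) f X ∧ Φ X) ↔
      ∃ z : τ → Option (Fin I.m), ∃ X : Finset (Fin I.m),
        (∀ c, c ∈ X ↔ ∃ j, ∃ a ∈ z j, I.Same c a ∧ I.rank a ≤ I.rank c) ∧ Φ X := by
  classical
  -- The position of the end marker is not the start of a line and encodes the absent cut `none`.
  have hend : ∀ a, I.pos a ≠ I.tape.length - 1 := fun a => by
    have := I.pos_add_lt a
    omega
  have hpos : 0 < I.tape.length := by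
    rw [length_tape]
    omega
  let E := Fintype.equivFin τ
  constructor
  · rintro ⟨f, -, X, hX, h⟩
    refine ⟨fun j => if h : ∃ a, f (E j) = I.pos a then some h.choose else none, X, fun c => ?_, h⟩
    have hz : ∀ j a, a ∈ (if h : ∃ a, f (E j) = I.pos a then some h.choose else none) ↔
        f (E j) = I.pos a := by
      intro j a
      split_ifs with h
      · rw [Option.mem_some_iff]
        exact ⟨fun e => e ▸ h.choose_spec, fun e => I.pos_injective (h.choose_spec.symm.trans e)⟩
      · exact iff_of_false (by simp) fun e => h ⟨a, e⟩
    simp only [hz]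
    rw [hX c]
    constructor
    · rintro ⟨j, hj, h⟩
      exact ⟨E.symm ⟨j, hj⟩, by simpa using h⟩
    · rintro ⟨j, h⟩
      exact ⟨E j, (E j).2, h⟩
  · rintro ⟨z, X, hX, h⟩
    refine ⟨fun i => if hi : i < Fintype.card τ then
      (z (E.symm ⟨i, hi⟩)).elim (I.tape.length - 1) I.pos else 0, fun i hi => ?_, X, fun c => ?_, h⟩
    · simp only [hi, dif_pos]
      cases z (E.symm ⟨i, hi⟩) with
      | none => simpa using hpos
      | some a => exact I.pos_lt a
    · rw [hX c]
      have hz : ∀ j a, a ∈ z j ↔ (z j).elim (I.tape.length - 1) I.pos = I.pos a := by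
        intro j a
        cases z j with
        | none => simpa using (hend a).symm
        | some b => simp [I.pos_injective.eq_iff]
      constructor
      · rintro ⟨j, a, ha, h⟩
        exact ⟨E j, (E j).2, a, by simpa [← hz] using ha, h⟩
      · rintro ⟨i, hi, a, ha, h⟩
        exact ⟨E.symm ⟨i, hi⟩, a, by simpa [hz, hi] using ha, h⟩

/-- The formula `manipulationF` expresses coalition manipulation with goal `q v y` for the
manipulator `v` and the new winning committee `y`, if `φ` expresses the corresponding condition
`R`. -/
theorem holds_manipulationF {t : ℕ} (ht : I.VM.length ≤ t) {φ : Formula}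
    {q : Finset (Fin I.m) → Finset (Fin I.m) → Prop}
    {R : Finset (Fin I.m) → Finset (Fin I.m) → Finset (Fin I.m) → Finset (Fin I.m) → Prop}
    (hφ : ∀ e X F G, I.IsPromoted (Fintype.card (Bool × (Fin t → Bool))) e X →
      e (Fintype.card (Bool × (Fin t → Bool))) < I.tape.length →
      (∀ c, c ∈ F ↔
        e (Fintype.card (Bool × (Fin t → Bool))) < boost I.score I.VM.length X c) →
      (∀ c, c ∈ G ↔
        e (Fintype.card (Bool × (Fin t → Bool))) ≤ boost I.score I.VM.length X c) →
      e (Fintype.card (Bool × (Fin t → Bool)) + 2) < I.numVotes →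
      (Holds I.tape φ e ↔ R F G I.w (I.vote (e (Fintype.card (Bool × (Fin t → Bool)) + 2)))))
    (hR : ∀ F G : Finset (Fin I.m), F ⊆ G → F.card ≤ I.w.card → I.w.card ≤ G.card → ∀ v,
      (∀ y : Finset (Fin I.m), y.card = I.w.card → F ⊆ y → y ⊆ G → q v y) ↔ R F G I.w v)
    (hq : ∀ c d : Fin I.m, ∀ v, (c ∈ I.w ↔ d ∈ I.w) → (c ∈ v ↔ d ∈ v) → ∀ y : Finset (Fin I.m),
      q v (y.map (Equiv.swap c d).toEmbedding) → q v y) (e : ℕ → ℕ) :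
    Holds I.tape (manipulationF (Fintype.card (Bool × (Fin t → Bool))) φ) e ↔
      ∃ U : Multiset (Finset (Fin I.m)), U.card = I.VM.length ∧
        ∀ y ∈ AV ((I.V : Multiset (Finset (Fin I.m))) + U) I.w.card, ∀ v ∈ I.VM, q v y := by
  set K := Fintype.card (Bool × (Fin t → Bool)) with hK
  have hN := I.numVotes_lt
  -- New scores are at most `numVotes`, which is below the length of the tape, so a position can
  -- hold the threshold even if there are no candidates.
  rw [exists_votes_iff_exists_cuts (I.V : Multiset (Finset (Fin I.m))) I.VM.length I.w.card
    (Finset.card_le_univ _) (B := I.tape.length - 1)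
    (by rw [Multiset.coe_card]; unfold numVotes at hN; omega)
    (fun y => ∀ v ∈ I.VM, q v y) (I.candidateType t) I.rank rank_injective
    (fun c d => score_le_of_rank_lt) (fun c d hcd y h v hv => ?_)]
  rotate_left
  · rw [candidateType_eq_iff ht] at hcd
    refine hq c d v hcd.1 ?_ y (h v hv)
    exact (I.forall_manipulator_iff fun v => (c ∈ v ↔ d ∈ v)).2 hcd.2 v hv
  simp only [candidateType_eq_iff ht]
  have key : ∀ θ, (∃ z : Bool × (Fin t → Bool) → Option (Fin I.m), ∃ X F G : Finset (Fin I.m),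
        (∀ c, c ∈ X ↔ ∃ j, ∃ a ∈ z j, I.Same c a ∧ I.rank a ≤ I.rank c) ∧
        (∀ c, c ∈ F ↔ θ < boost I.score I.VM.length X c) ∧
        (∀ c, c ∈ G ↔ θ ≤ boost I.score I.VM.length X c) ∧
        F.card ≤ I.w.card ∧ I.w.card ≤ G.card ∧
        ∀ y : Finset (Fin I.m), y.card = I.w.card → F ⊆ y → y ⊆ G → ∀ v ∈ I.VM, q v y) ↔
      ∃ f : ℕ → ℕ, (∀ i < K, f i < I.tape.length) ∧ ∃ X, I.IsPromoted K f X ∧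
        ∃ F G : Finset (Fin I.m), (∀ c, c ∈ F ↔ θ < boost I.score I.VM.length X c) ∧
        (∀ c, c ∈ G ↔ θ ≤ boost I.score I.VM.length X c) ∧
        F.card ≤ I.w.card ∧ I.w.card ≤ G.card ∧ ∀ i < I.VM.length, R F G I.w (I.vote i) := by
    intro θ
    rw [hK, exists_isPromoted_iff]
    refine exists_congr fun z => exists_congr fun X => ?_
    constructor
    · rintro ⟨F, G, hX, hF, hG, h₁, h₂, h₃⟩
      refine ⟨hX, F, G, hF, hG, h₁, h₂, (I.forall_manipulator_iff (R F G I.w)).1 fun v hv => ?_⟩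
      exact (hR F G (fun c hc => (hG c).2 ((hF c).1 hc).le) h₁ h₂ v).1
        fun y hy hFy hyG => h₃ y hy hFy hyG v hv
    · rintro ⟨hX, F, G, hF, hG, h₁, h₂, h₃⟩
      refine ⟨F, G, hX, hF, hG, h₁, h₂, fun y hy hFy hyG v hv => ?_⟩
      exact (hR F G (fun c hc => (hG c).2 ((hF c).1 hc).le) h₁ h₂ v).2
        ((I.forall_manipulator_iff (R F G I.w)).2 h₃ v hv) y hy hFy hyG
  change _ ↔ ∃ θ ≤ I.tape.length - 1, ∃ z : Bool × (Fin t → Bool) → Option (Fin I.m), _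
  refine Iff.trans ?_ (exists_congr fun θ => and_congr_right fun _ => (key θ).symm)
  rw [manipulationF, holds_exMany]
  -- The cuts and the threshold determine `X`, `F` and `G`, so the formula does not have to quantify
  -- over sets.
  have inner : ∀ e X F G, I.IsPromoted K e X → e K < I.tape.length →
      (∀ c, c ∈ F ↔ e K < boost I.score I.VM.length X c) →
      (∀ c, c ∈ G ↔ e K ≤ boost I.score I.VM.length X c) →
      (Holds I.tape (and (and (cmp (K + 1) (candidateF K (exceedsF K (K + 1)))
          (candidateF K (memberF (K + 1)))) (cmp (K + 1) (candidateF K (memberF (K + 1)))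
          (candidateF K (reachesF K (K + 1)))))
        (all (K + 2) (or (not (symF (K + 2) .manipulator)) φ))) e ↔
      F.card ≤ I.w.card ∧ I.w.card ≤ G.card ∧ ∀ i < I.VM.length, R F G I.w (I.vote i)) := by
    intro e X F G hX hθ hF hG
    rw [holds_and, holds_and, holds_cmp, holds_cmp, and_assoc,
      posCount_candidateF F fun c => holds_exceedsF_update hX hθ hF c,
      posCount_candidateF G fun c => holds_reachesF_update hX hθ hG c,
      posCount_candidateF I.w fun c => holds_memberF_update _ c, holds_all]
    refine and_congr_right fun _ => and_congr_right fun _ => ?_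
    have h : ∀ i < I.tape.length,
        (Holds I.tape (or (not (symF (K + 2) .manipulator)) φ) (Function.update e (K + 2) i) ↔
          (i < I.VM.length → R F G I.w (I.vote i))) := by
      intro i hi
      rw [holds_or, holds_not, symF, holds_sym, Function.update_self, tape_eq_manipulator_iff,
        ← imp_iff_not_or]
      refine imp_congr_right fun hi' => ?_
      rw [hφ (Function.update e (K + 2) i) X F G (hX.update (by omega)) (by simpa using hθ)
        (by simpa using hF) (by simpa using hG)
        (by simpa using hi'.trans_le I.manipulators_le), Function.update_self]
    exact ⟨fun h' i hi => (h i ((hi.trans_le I.manipulators_le).trans hN)).1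
        (h' i ((hi.trans_le I.manipulators_le).trans hN)) hi,
      fun h' i hi => (h i hi).2 (h' i)⟩
  constructor
  · rintro ⟨f, hf, h⟩
    classical
    have hX : I.IsPromoted K f (Finset.univ.filter fun c =>
        ∃ j < K, ∃ a, f j = I.pos a ∧ I.Same c a ∧ I.rank a ≤ I.rank c) := fun c => by simp
    have hK' := hf K (by omega)
    refine ⟨f K, by omega, f, fun i hi => hf i (by omega), _, hX,
      Finset.univ.filter fun c => f K < boost I.score I.VM.length _ c,
      Finset.univ.filter fun c => f K ≤ boost I.score I.VM.length _ c,
      fun c => by simp only [Finset.mem_filter, Finset.mem_univ, true_and]; rfl,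
      fun c => by simp only [Finset.mem_filter, Finset.mem_univ, true_and]; rfl, ?_⟩
    refine (inner _ _ _ _ (fun c => (hX c).trans ?_) ?_ (fun c => ?_) (fun c => ?_)).1 h
    · refine exists_congr fun j => and_congr_right fun hj => ?_
      rw [if_pos (by omega)]
    · simpa using hK'
    · simp
    · simp
  -- The cuts occupy the variables below `K`, so the value at `K` is free to be the threshold.
  · rintro ⟨θ, hθ, f, hf, X, hX, F, G, hF, hG, h⟩
    refine ⟨Function.update f K θ, fun i hi => ?_, ?_⟩
    · rcases eq_or_ne i K with rfl | hne
      · rw [Function.update_self]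
        omega
      · rw [Function.update_of_ne hne]
        exact hf i (by omega)
    · refine (inner _ X F G (fun c => (hX c).trans ?_) ?_ (fun c => ?_) (fun c => ?_)).2 h
      · refine exists_congr fun j => and_congr_right fun hj => ?_
        rw [if_pos (by omega), Function.update_of_ne (by omega)]
      · rw [if_pos (by omega), Function.update_self]
        omega
      · rw [if_pos (by omega), Function.update_self]
        exact hF c
      · rw [if_pos (by omega), Function.update_self]
        exact hG c

end ManipulationInstance

/-! ### The two manipulation problems -/

open CountingFormula ManipulationInstance

theorem mainTheorem8 (t : ℕ) :
    PolyTimeSolvable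
      (fun I : {I : ManipulationInstance // I.VM.length ≤ t} => I.1.encode)
      (fun I => CBCM AV (I.1.V : Multiset (Finset (Fin I.1.m)))
        (I.1.VM : Multiset (Finset (Fin I.1.m))) I.1.w) ∧
    PolyTimeSolvable
      (fun I : {I : ManipulationInstance // I.VM.length ≤ t} => I.1.encode)
      (fun I => SBCM AV (I.1.V : Multiset (Finset (Fin I.1.m)))
        (I.1.VM : Multiset (Finset (Fin I.1.m))) I.1.w) := by
  constructor
  · refine polyTimeSolvable_of_countingFormula _ _
      (manipulationF (Fintype.card (Bool × (Fin t → Bool)))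
        (cardConditionF (Fintype.card (Bool × (Fin t → Bool))))) ?_
    rintro ⟨I, hI⟩
    refine (holds_manipulationF hI (q := fun v y => (v ∩ I.w).card < (v ∩ y).card)
      (R := CardCondition) (fun e X F G hX hθ hF hG hi => holds_cardConditionF hX hθ hF hG hi)
      (fun F G hFG hF hG v => forall_card_lt_iff hFG hF hG v)
      (fun c d v _ hv y h => ?_) _).trans ?_
    · rwa [inter_map_swap hv, Finset.card_map] at h
    · simp [CBCM]
  · refine polyTimeSolvable_of_countingFormula _ _
      (manipulationF (Fintype.card (Bool × (Fin t → Bool)))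
        (and (cardConditionF (Fintype.card (Bool × (Fin t → Bool))))
          (subsetConditionF (Fintype.card (Bool × (Fin t → Bool)))))) ?_
    rintro ⟨I, hI⟩
    refine (holds_manipulationF hI (q := fun v y => v ∩ I.w ⊂ v ∩ y)
      (R := fun F G w v => CardCondition F G w v ∧ SubsetCondition F G w v)
      (fun e X F G hX hθ hF hG hi => ?_) (fun F G hFG hF hG v => ?_)
      (fun c d v hw hv y h => ?_) _).trans ?_
    · rw [holds_and, holds_cardConditionF hX hθ hF hG hi, holds_subsetConditionF hX hθ hF hG hi]
    · rw [← forall_card_lt_iff hFG hF hG, ← forall_subset_iff hFG hF hG]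
      -- Strict inclusion is inclusion together with a strict inequality of cardinalities, so the
      -- subset goal is the conjunction of both conditions.
      have : ∀ y, v ∩ I.w ⊂ v ∩ y ↔ (v ∩ I.w).card < (v ∩ y).card ∧ v ∩ I.w ⊆ y := by
        refine fun y => ⟨fun h => ⟨Finset.card_lt_card h, h.1.trans Finset.inter_subset_right⟩,
          fun h => ?_⟩
        refine ⟨Finset.subset_inter Finset.inter_subset_left h.2, fun h' => ?_⟩
        exact h.1.not_ge (Finset.card_le_card h')
      simp only [this]
      exact ⟨fun h => ⟨fun y a b c => (h y a b c).1, fun y a b c => (h y a b c).2⟩,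
        fun h y a b c => ⟨h.1 y a b c, h.2 y a b c⟩⟩
    -- A swap within a type also fixes `v ∩ w`, because types record membership in `w`.
    · have hvw : c ∈ v ∩ I.w ↔ d ∈ v ∩ I.w := by simp [hw, hv]
      rw [inter_map_swap hv, ← map_swap_eq_self hvw] at h
      exact Finset.map_ssubset_map.1 h
    · simp [SBCM]
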